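/- A configuration is a sequence $c=(c_i)_{i\in\mathbb Z}$ of nonnegative integers with only finitely many positive values, $c_i$ being the number of grains on column $i$. The left rule $\mathcal L$ is applicable to $a$ on column $i$ if $a_{i-1}+2\le a_i$, and moves one grain from column $i$ to column $i-1$; the right rule $\mathcal R$ is applicable on column $i$ if $a_{i+1}+2\le a_i$, and moves one grain from column $i$ to column $i+1$. A transition of the Symmetric Sand Pile Model (SSPM) consists of one application of $\mathcal L$ or of $\mathcal R$ on one column. A transition of the Parallel Symmetric Sand Pile Model (PSSPM) applies simultaneously, on every column on which at least one of the rules is applicable, exactly one applicable rule (chosen freely if both are applicable); there must be at least one such column. For an integer $n\ge 0$, SSPM($n$) and PSSPM($n$) are the sets of configurations reachable by finitely many (possibly zero) transitions of the respective model from the configuration with $n$ grains on column $0$ and no other grain. A fixed point of SSPM($n$), resp. PSSPM($n$), is an element of this set from which no transition of the respective model is possible. Configurations are ordered lexicographically: $a<_{lex}b$ if $a\ne b$ and $a_i<b_i$ at the smallest $i$ with $a_i\neq b_i$. Write $a\triangleleft b$ if there are $i<j$ with $a_i-b_i=-1$, $a_j-b_j=1$, and $a_m=b_m$ for all $m\notin\{i,j\}$.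 **Theorem.** Let $n\ge 0$. The set of fixed points of PSSPM($n$) is finite and nonempty; let $\pi_0<_{lex}\pi_1<_{lex}\dots<_{lex}\pi_k$ be its elements in lexicographic order. Then $$\pi_0\triangleleft\pi_1\triangleleft\dots\triangleleft\pi_k.$$ Moreover, each $\pi_i$ is a fixed point of SSPM($n$), and for every fixed point $\pi$ of SSPM($n$) with $\pi_0\le_{lex}\pi\le_{lex}\pi_k$ there is an index $0\le i\le k$ with $\pi_i=\pi$. In other words, the fixed points of PSSPM($n$) form an interval of the lexicographically ordered set of fixed points of SSPM($n$). -/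

import Mathlib

namespace SandPile

/-- A configuration: a bi-infinite sequence of nonnegative integers with finitely many
positive values; the value at `i : ℤ` is the number of grains on column `i`. -/
abbrev Config : Type := ℤ →₀ ℕ

/-- The initial configuration: `n` grains stacked on column `0`. -/
noncomputable def initial (n : ℕ) : Config := Finsupp.single 0 n

/-- The left rule applies on column `i`. -/
def CanLeft (a : Config) (i : ℤ) : Prop := a (i - 1) + 2 ≤ a i

/-- The right rule applies on column `i`. -/
def CanRight (a : Config) (i : ℤ) : Prop := a (i + 1) + 2 ≤ a i

/-- One transition of the sequential model SSPM: exactly one grain of one column falls to its left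
or to its right neighbouring column. -/
def SeqStep (a b : Config) : Prop :=
  ∃ i : ℤ,
    (CanLeft a i ∧ b + Finsupp.single i 1 = a + Finsupp.single (i - 1) 1) ∨
    (CanRight a i ∧ b + Finsupp.single i 1 = a + Finsupp.single (i + 1) 1)

/-- One transition of the parallel model PSSPM. `L` and `R` are the sets of columns on which the
left and the right rule are applied. At most one of the rules is applied on each column, some rule
is applied on every column where this is possible, and there is at least one such column. -/
def ParStep (a b : Config) : Prop :=
  ∃ L R : Finset ℤ,
    (∀ i ∈ L, CanLeft a i) ∧
    (∀ i ∈ R, CanRight a i) ∧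
    Disjoint L R ∧
    (∀ i, CanLeft a i ∨ CanRight a i → i ∈ L ∪ R) ∧
    (L ∪ R).Nonempty ∧
    ∀ i, b i + (if i ∈ L ∪ R then 1 else 0)
      = a i + (if i + 1 ∈ L then 1 else 0) + (if i - 1 ∈ R then 1 else 0)

/-- The configurations reachable (in zero or more transitions) from `n` stacked grains. -/
def reachable (step : Config → Config → Prop) (n : ℕ) : Set Config :=
  {a | Relation.ReflTransGen step (initial n) a}

/-- The fixed points reachable from `n` stacked grains: the reachable configurations from which
no transition is possible. -/
def fixedPoints (step : Config → Config → Prop) (n : ℕ) : Set Config :=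
  {a | a ∈ reachable step n ∧ ∀ b, ¬ step a b}

/-- The set of fixed points of `SSPM(n)`. -/
def sspmFixedPoints (n : ℕ) : Set Config := fixedPoints SeqStep n

/-- The set of fixed points of `PSSPM(n)`. -/
def psspmFixedPoints (n : ℕ) : Set Config := fixedPoints ParStep n

/-- `a ◁ b`: the sequence of differences `a i - b i` has the form `0* (-1) 0* 1 0*`. -/
def Closer (a b : Config) : Prop :=
  ∃ i j : ℤ, i < j ∧ ∀ m : ℤ,
    (a m : ℤ) - (b m : ℤ) = if m = i then -1 else if m = j then 1 else 0

end SandPile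

/-!
The proof compares configurations through their prefix sums `F i = ∑ j ≤ i, c j`. In terms of `F`
the left rule raises `F i` by one where the second difference of `F` is at least `2`, and the right rule
lowers it where the second difference is at most `-2`. Apart from the choice on a peak from which a
grain can fall to both sides, a parallel transition is therefore a monotone map which commutes with
adding constants to `F`. Hence two configurations whose prefix sums differ by `0` or `1` everywhere
(`Near`) and which have a common split, as defined below, have near successors (`Edge.exists_near`),
and any two successors of one configuration are near (`ParMove.near_or_near`).

Every reachable configuration can be cut between two columns `p` and `p + 1` into two monotone slopes
on which any two plateaus are separated by a cliff (`Split`). If two near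
configurations have a common split, then so have any successors of them that are near again
(`exists_common_split`). Consequently, for every `t`, the
configurations reached after exactly `t` parallel transitions (with idling on fixed points) form a
connected graph under the relation `Edge`, "near with a common split" (`stage_connected`). Since the
sum of the squares of the heights decreases, for large `t` these are exactly the fixed points.

A fixed point that splits at `p` consists of two staircases with at most one repeated height each, so
that it is determined by `p` and the number of grains `F p` on the left. The split is not unique, but
the index `F p - √n * p` does not depend on it, because the column between two adjacent splits has
height `√n`, rounded down. The index determines the fixed point (`Settled.eq_of_index_eq`), and moving
one grain from the right staircase to the left one, possibly after a change of the split,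
raises it by one (`Settled.exists_next`). So the index is strictly monotone with respect to the
lexicographic order, and fixed points with consecutive indices are related by `◁`. Along an edge the
index changes by at most one; hence the fixed points of the parallel model, being connected, realize
an interval of indices, which is the assertion. Finally, a parallel transition of a configuration
without valleys is a sequence of single moves (`LegalMove.reflTransGen`), so that these fixed points
are also fixed points of the sequential model.
-/

/-! ### Slopes with at most one plateau between cliffs -/

namespace SandPile

/-- The heights increase weakly up to column `p`, and any two plateaus among the positive ones are separated by
a cliff (a step of height at least two). Both conditions are expressed at once: over a distance
`j - i` the height increases by at least `j - i - 1`. -/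
def LeftValid (c : ℤ → ℤ) (p : ℤ) : Prop :=
  ∀ i j, i < j → j ≤ p → 0 < c i → c i + (j - i - 1) ≤ c j

/-- The mirror image of `LeftValid`, for the columns to the right of `p`. -/
def RightValid (c : ℤ → ℤ) (p : ℤ) : Prop :=
  ∀ i j, p < i → i < j → 0 < c j → c j + (j - i - 1) ≤ c i

/-- The configuration `c` splits between the columns `p` and `p + 1` into two valid slopes. -/
def Split (c : ℤ → ℤ) (p : ℤ) : Prop := LeftValid c p ∧ RightValid c p

/-- `c'` arises from `c` by simultaneous legal moves. The `0`-`1`-valued functions `l` and `r`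
indicate the columns on which the left and the right rule are applied; it is not required that
every column that can move does so. -/
structure Fires (c c' l r : ℤ → ℤ) : Prop where
  nonneg : ∀ i, 0 ≤ c i
  left : ∀ i, l i = 0 ∨ l i = 1 ∧ c (i - 1) + 2 ≤ c i
  right : ∀ i, r i = 0 ∨ r i = 1 ∧ c (i + 1) + 2 ≤ c i
  disj : ∀ i, l i + r i ≤ 1
  eq : ∀ i, c' i = c i - l i - r i + l (i + 1) + r (i - 1)

variable {c c' l r : ℤ → ℤ} {p : ℤ}

theorem Fires.mirror (h : Fires c c' l r) :
    Fires (fun i => c (-i)) (fun i => c' (-i)) (fun i => r (-i)) (fun i => l (-i)) where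
  nonneg i := h.nonneg _
  left i := by have := h.right (-i); rwa [show -(i - 1) = -i + 1 by ring]
  right i := by have := h.left (-i); rwa [show -(i + 1) = -i - 1 by ring]
  disj i := by have := h.disj (-i); omega
  eq i := by
    have := h.eq (-i)
    rw [show -(i - 1) = -i + 1 by ring, show -(i + 1) = -i - 1 by ring]
    omega

theorem leftValid_mirror : LeftValid (fun i => c (-i)) (-p - 1) ↔ RightValid c p := by
  constructor
  · intro h i j hi hij hj
    have := h (-j) (-i) (by omega) (by omega) (by simpa using hj)
    simp only [neg_neg] at this
    omega
  · intro h i j hij hj hi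
    have := h (-j) (-i) (by omega) (by omega) hi
    dsimp only
    omega

theorem rightValid_mirror : RightValid (fun i => c (-i)) (-p - 1) ↔ LeftValid c p := by
  have := leftValid_mirror (c := fun i => c (-i)) (p := -p - 1)
  simp only [neg_neg, neg_sub] at this
  rw [← this, show (1 : ℤ) - -p - 1 = p by ring]

theorem split_mirror : Split (fun i => c (-i)) (-p - 1) ↔ Split c p := by
  unfold Split
  rw [leftValid_mirror, rightValid_mirror, and_comm]

theorem LeftValid.mono (h : LeftValid c p) {q : ℤ} (hq : q ≤ p) : LeftValid c q :=
  fun i j hij hj => h i j hij (hj.trans hq)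

theorem RightValid.mono (h : RightValid c p) {q : ℤ} (hq : p ≤ q) : RightValid c q :=
  fun i j hi => h i j (by omega)

theorem LeftValid.right_eq_zero (h : LeftValid c p) (hf : Fires c c' l r) {i : ℤ} (hi : i < p) :
    r i = 0 := by
  rcases hf.right i with h0 | ⟨-, h2⟩
  · exact h0
  · have := h i (i + 1) (by omega) (by omega) (by have := hf.nonneg (i + 1); omega)
    omega

/-- A valid left slope stays valid as long as it does not lose its top grain to the right. -/
theorem LeftValid.fires (h : LeftValid c p) (hf : Fires c c' l r) (hp : r p = 0) :
    LeftValid c' p := by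
  have hr : ∀ i ≤ p, r i = 0 := fun i hi => by
    rcases hi.lt_or_eq with hi | rfl
    · exact h.right_eq_zero hf hi
    · exact hp
  intro i j hij hj hi
  have ei := hf.eq i
  have ej := hf.eq j
  rw [hr i (by omega), hr (i - 1) (by omega)] at ei
  rw [hr j hj, hr (j - 1) (by omega)] at ej
  have n0 := hf.nonneg i
  have n1 := hf.nonneg (i - 1)
  have n2 := hf.nonneg (j - 1)
  have li := hf.left i
  have li' := hf.left (i + 1)
  have lj := hf.left j
  have lj' := hf.left (j + 1)
  rw [add_sub_cancel_right] at li' lj'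
  rcases (show j = i + 1 ∨ i + 1 < j by omega) with rfl | hij'
  · have := h i (i + 1) (by omega) hj
    rw [add_sub_cancel_right] at lj
    omega
  · have h1 := h i j hij hj
    have h2 := h (i + 1) j hij' hj
    have h3 := h i (j - 1) (by omega) (by omega)
    rcases (show j = i + 2 ∨ i + 1 < j - 1 by omega) with rfl | h4
    · rw [show i + 2 - 1 = i + 1 by ring] at *
      omega
    · have h5 := h (i + 1) (j - 1) h4 (by omega)
      omega

theorem RightValid.fires (h : RightValid c p) (hf : Fires c c' l r) (hp : l (p + 1) = 0) :
    RightValid c' p := by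
  rw [← leftValid_mirror] at h ⊢
  refine h.fires hf.mirror ?_
  simpa [show -(-p - 1) = p + 1 by ring] using hp

/-- A split is kept by moves that do not carry a grain across it. -/
theorem Split.fires (h : Split c p) (hf : Fires c c' l r) (hr : r p = 0) (hl : l (p + 1) = 0) :
    Split c' p :=
  ⟨h.1.fires hf hr, h.2.fires hf hl⟩

theorem RightValid.cons (h : RightValid c p) (hp : c (p + 1) + 1 ≤ c p) :
    RightValid c (p - 1) := by
  intro i j hi hij hj
  rcases (show i = p ∨ p < i by omega) with rfl | hi
  · rcases (show j = i + 1 ∨ i + 1 < j by omega) with rfl | hij'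
    · omega
    · have := h (i + 1) j (by omega) hij' hj
      omega
  · exact h i j hi hij hj

/-- If a grain crosses the split to the right, then the split can be moved by one column to the
left, so that no grain crosses it. -/
theorem Split.fires_right (h : Split c p) (hf : Fires c c' l r) (hr : r p = 1) :
    Split c (p - 1) ∧ r (p - 1) = 0 ∧ l p = 0 := by
  refine ⟨⟨h.1.mono (by omega), h.2.cons ?_⟩, h.1.right_eq_zero hf (by omega), ?_⟩
  · have := hf.right p
    omega
  · have := hf.left p
    have := hf.disj p
    omega

theorem Split.fires_left (h : Split c p) (hf : Fires c c' l r) (hl : l (p + 1) = 1) :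
    Split c (p + 1) ∧ r (p + 1) = 0 ∧ l (p + 1 + 1) = 0 := by
  have h' := split_mirror.2 h
  have key := h'.fires_right hf.mirror (by simpa [show -(-p - 1) = p + 1 by ring] using hl)
  rw [show -p - 1 - 1 = -(p + 1) - 1 by ring, split_mirror] at key
  refine ⟨key.1, ?_, ?_⟩
  · simpa [show -(-p - 1) = p + 1 by ring] using key.2.2
  · have := key.2.1
    rwa [show -(-(p + 1) - 1) = p + 1 + 1 by ring] at this

theorem Fires.exists_split (hf : Fires c c' l r) (h : Split c p) : ∃ q, Split c' q := by
  rcases hf.right p with hr | ⟨hr, -⟩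
  · rcases hf.left (p + 1) with hl | ⟨hl, -⟩
    · exact ⟨p, h.fires hf hr hl⟩
    · obtain ⟨h1, h2, h3⟩ := h.fires_left hf hl
      exact ⟨p + 1, h1.fires hf h2 h3⟩
  · obtain ⟨h1, h2, h3⟩ := h.fires_right hf hr
    exact ⟨p - 1, h1.fires hf h2 (by simpa using h3)⟩

end SandPile

/-! ### Two configurations with a common split -/

namespace SandPile

variable {a a' la ra b b' lb rb c c' l r D : ℤ → ℤ} {p : ℤ}

/-- If the left slope has no plateau in front of its first cliff, then the split is kept even when
the top grain of the slope crosses it to the right. -/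
theorem Split.fires_right_keep (h : Split c p) (hf : Fires c c' l r) (hr : r p = 1)
    (hA : ∀ j < p, 0 < c j → c j + (p - j) ≤ c p) : Split c' p := by
  have hcliff : c (p + 1) + 2 ≤ c p := by have := hf.right p; omega
  have hl1 : l (p + 1) = 0 := by
    have := hf.left (p + 1)
    rw [add_sub_cancel_right] at this
    omega
  have hl0 : l p = 0 := by have := hf.left p; have := hf.disj p; omega
  refine ⟨?_, h.2.fires hf hl1⟩
  have hr' : ∀ i < p, r i = 0 := fun i hi => h.1.right_eq_zero hf hi
  have hleft := (h.1.mono (by omega : p - 1 ≤ p)).fires hf (hr' _ (by omega))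
  intro i j hij hj hi
  rcases hj.lt_or_eq with hj | rfl
  · exact hleft i j hij (by omega) hi
  · have ei := hf.eq i
    have ej := hf.eq j
    rw [hr' i hij, hr' _ (by omega)] at ei
    rw [hl0, hr, hl1, hr' _ (by omega)] at ej
    have hi0 := hf.left i
    have hi1 := hf.left (i + 1)
    rw [add_sub_cancel_right] at hi1
    have n0 := hf.nonneg i
    have n1 := hf.nonneg (i - 1)
    have h0 := hA i hij
    rcases (show j = i + 1 ∨ i + 1 < j by omega) with rfl | hij'
    · omega
    · have h1 := hA (i + 1) hij'
      omega

/-- A gradient field that never raises the height keeps the value `1` to the left. -/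
theorem gradient_eq_one_of_le (hD : ∀ i, D i = 0 ∨ D i = 1)
    (hab : ∀ i, b i = a i + D i - D (i - 1)) {j q : ℤ} (hjq : j ≤ q) (hq : D q = 1)
    (hle : ∀ m, j < m → m ≤ q → b m ≤ a m) : D j = 1 := by
  have key : ∀ n : ℕ, j ≤ q - n → D (q - n) = 1 := by
    intro n
    induction n with
    | zero => intro _; simpa using hq
    | succ n ih =>
      intro hn
      push_cast at hn ⊢
      have hm := ih (by omega)
      have h1 := hle (q - n) (by omega) (by omega)
      have h2 := hab (q - n)
      have h3 := hD (q - n - 1)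
      rw [show q - ((n : ℤ) + 1) = q - n - 1 by ring]
      omega
  have := key (q - j).toNat (by omega)
  rwa [show q - ((q - j).toNat : ℤ) = j by omega] at this

/-- Let `a` and `b` differ by the gradient of a `0`-`1`-valued function `D`, and let the split `p`
be common to both. If `a` has a plateau in front of its first cliff to the left of the split, then
`D` vanishes on column `p - 1`: otherwise `D = 1` on all columns from the plateau to `p - 1`, and
the slope of `b` would be too flat. -/
theorem gradient_eq_zero_of_plateau (hD : ∀ i, D i = 0 ∨ D i = 1)
    (hab : ∀ i, b i = a i + D i - D (i - 1)) (hna : ∀ i, 0 ≤ a i) (hp : D p = 0)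
    (ha : LeftValid a p) (hb : LeftValid b p) {j : ℤ} (hj : j < p) (haj : 0 < a j)
    (hflat : a p < a j + (p - j)) : D (p - 1) = 0 := by
  by_contra hne
  have h1 : D (p - 1) = 1 := by have := hD (p - 1); omega
  have hbp := hab p
  have hDj : D j = 1 := by
    refine gradient_eq_one_of_le hD hab (by omega) h1 fun m h2 h3 => ?_
    by_contra! hlt
    have e := hab m
    have := hD m
    have := hD (m - 1)
    have n0 := hna m
    have q1 := hb m p (by omega) le_rfl (by omega)
    have q2 := ha j m (by omega) (by omega) haj
    omega
  have e := hab j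
  have := hD (j - 1)
  have q1 := hb j p hj le_rfl (by omega)
  omega

/-- In the situation of `gradient_eq_zero_of_plateau`, the column `p` of `b` cannot lose a grain
to the left. -/
theorem not_canLeft_of_plateau (hD : ∀ i, D i = 0 ∨ D i = 1)
    (hab : ∀ i, b i = a i + D i - D (i - 1)) (hna : ∀ i, 0 ≤ a i) (hp : D p = 0)
    (ha : LeftValid a p) (hb : LeftValid b p) {j : ℤ} (hj : j < p) (haj : 0 < a j)
    (hflat : a p < a j + (p - j)) : b p < b (p - 1) + 2 := by
  by_contra! hcan
  have h0 := gradient_eq_zero_of_plateau hD hab hna hp ha hb hj haj hflat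
  have e0 := hab p
  have e1 := hab (p - 1)
  rw [show p - 1 - 1 = p - 2 by ring] at e1
  have d2 := hD (p - 2)
  rcases (show j = p - 1 ∨ j < p - 1 by omega) with rfl | hj'
  · omega
  have h1 := ha j (p - 1) hj' (by omega) haj
  have h2 : D (p - 2) = 1 := by omega
  have hDj : D j = 1 := by
    refine gradient_eq_one_of_le hD hab (by omega) h2 fun m h3 h4 => ?_
    by_contra! hlt
    have e := hab m
    have := hD m
    have := hD (m - 1)
    have n0 := hna m
    have q1 := hb m (p - 1) (by omega) (by omega) (by omega)
    have q2 := ha j m (by omega) (by omega) haj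
    omega
  have e := hab j
  have := hD (j - 1)
  have q1 := hb j (p - 1) hj' (by omega) (by omega)
  omega

/-- If a grain of `a` crosses the common split `p` to the right and no grain of `b` crosses it,
then the successors have one of the splits `p` and `p - 1` in common. -/
theorem exists_common_split_of_right (hD : ∀ i, D i = 0 ∨ D i = 1)
    (hab : ∀ i, b i = a i + D i - D (i - 1)) (hp : D p = 0)
    (ha : Split a p) (hb : Split b p) (fa : Fires a a' la ra) (fb : Fires b b' lb rb)
    (hra : ra p = 1) (hrb : rb p = 0) (hlb : lb (p + 1) = 0) :
    ∃ q, Split a' q ∧ Split b' q := by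
  by_cases hA : ∀ j < p, 0 < a j → a j + (p - j) ≤ a p
  · exact ⟨p, ha.fires_right_keep fa hra hA, hb.fires fb hrb hlb⟩
  · push Not at hA
    obtain ⟨j, hj, haj, hflat⟩ := hA
    have h0 := gradient_eq_zero_of_plateau hD hab fa.nonneg hp ha.1 hb.1 hj haj hflat
    have h1 := not_canLeft_of_plateau hD hab fa.nonneg hp ha.1 hb.1 hj haj hflat
    obtain ⟨s1, s2, s3⟩ := ha.fires_right fa hra
    refine ⟨p - 1, s1.fires fa s2 (by simpa using s3), ?_⟩
    have hb1 : Split b (p - 1) := by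
      refine ⟨hb.1.mono (by omega), hb.2.cons ?_⟩
      have e0 := hab p
      have e1 := hab (p + 1)
      rw [add_sub_cancel_right] at e1
      have := hD (p + 1)
      have := fa.right p
      omega
    refine hb1.fires fb (hb.1.right_eq_zero fb (by omega)) ?_
    have := fb.left p
    rw [sub_add_cancel]
    omega

theorem exists_common_split_of_left (hD : ∀ i, D i = 0 ∨ D i = 1)
    (hab : ∀ i, b i = a i + D i - D (i - 1)) (hp : D p = 1)
    (ha : Split a p) (hb : Split b p) (fa : Fires a a' la ra) (fb : Fires b b' lb rb)
    (hla : la (p + 1) = 1) (hrb : rb p = 0) (hlb : lb (p + 1) = 0) :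
    ∃ q, Split a' q ∧ Split b' q := by
  obtain ⟨q, h1, h2⟩ := exists_common_split_of_right (D := fun i => 1 - D (-i - 1)) (p := -p - 1)
    (fun i => by have := hD (-i - 1); omega)
    (fun i => by
      have := hab (-i)
      rw [show -(i - 1) - 1 = -i by ring]
      omega)
    (by rw [show -(-p - 1) - 1 = p by ring]; omega)
    (split_mirror.2 ha) (split_mirror.2 hb) fa.mirror fb.mirror
    (by simpa [show -(-p - 1) = p + 1 by ring] using hla)
    (by simpa [show -(-p - 1) = p + 1 by ring] using hlb)
    (by rw [show -(-p - 1 + 1) = p by ring]; exact hrb)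
  refine ⟨-q - 1, ?_, ?_⟩ <;> rw [← split_mirror, show -(-q - 1) - 1 = q by ring] <;> assumption

/-- Let `F` be the difference of the prefix sums of `b` and `a`, and `F'` that of their
successors. If both take only the values `0` and `1` and if `a` and `b` have a common split, then
so have their successors. -/
theorem exists_common_split {F F' : ℤ → ℤ} (hF : ∀ i, F i = 0 ∨ F i = 1)
    (hF' : ∀ i, F' i = 0 ∨ F' i = 1) (hab : ∀ i, b i = a i + F i - F (i - 1))
    (fa : Fires a a' la ra) (fb : Fires b b' lb rb)
    (hstep : ∀ i, F' i = F i + (lb (i + 1) - rb i) - (la (i + 1) - ra i))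
    (ha : Split a p) (hb : Split b p) : ∃ q, Split a' q ∧ Split b' q := by
  have hs := hstep p
  have h0 := hF p
  have h1 := hF' p
  have hG : ∀ i, 1 - F i = 0 ∨ 1 - F i = 1 := fun i => by have := hF i; omega
  have hba : ∀ i, a i = b i + (1 - F i) - (1 - F (i - 1)) := fun i => by have := hab i; omega
  have ra' := fa.right p
  have rb' := fb.right p
  have la' := fa.left (p + 1)
  have lb' := fb.left (p + 1)
  rw [add_sub_cancel_right] at la' lb'
  by_cases e1 : ra p = 1
  · by_cases e2 : rb p = 1
    · obtain ⟨s1, s2, s3⟩ := ha.fires_right fa e1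
      obtain ⟨t1, t2, t3⟩ := hb.fires_right fb e2
      exact ⟨p - 1, s1.fires fa s2 (by simpa using s3), t1.fires fb t2 (by simpa using t3)⟩
    · exact exists_common_split_of_right hF hab (by omega) ha hb fa fb e1 (by omega) (by omega)
  by_cases e2 : rb p = 1
  · obtain ⟨q, h1, h2⟩ := exists_common_split_of_right hG hba (by omega) hb ha fb fa e2
      (by omega) (by omega)
    exact ⟨q, h2, h1⟩
  by_cases e3 : la (p + 1) = 1
  · by_cases e4 : lb (p + 1) = 1
    · obtain ⟨s1, s2, s3⟩ := ha.fires_left fa e3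
      obtain ⟨t1, t2, t3⟩ := hb.fires_left fb e4
      exact ⟨p + 1, s1.fires fa s2 s3, t1.fires fb t2 t3⟩
    · exact exists_common_split_of_left hF hab (by omega) ha hb fa fb e3 (by omega) (by omega)
  by_cases e4 : lb (p + 1) = 1
  · obtain ⟨q, h1, h2⟩ := exists_common_split_of_left hG hba (by omega) hb ha fb fa e4
      (by omega) (by omega)
    exact ⟨q, h2, h1⟩
  exact ⟨p, ha.fires fa (by omega) (by omega), hb.fires fb (by omega) (by omega)⟩

end SandPile

/-! ### Moves of configurations and prefix sums -/

namespace SandPile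

/-- The heights of a configuration as an integer-valued function. -/
def height (a : Config) (i : ℤ) : ℤ := a i

/-- The number of grains on the columns up to `i`. -/
noncomputable def prefixSum (a : Config) (i : ℤ) : ℤ :=
  a.sum fun j v => if j ≤ i then (v : ℤ) else 0

/-- The number of grains. -/
noncomputable def total (a : Config) : ℤ := a.sum fun _ v => (v : ℤ)

/-- The integer-valued indicator function of a finite set of columns. -/
def indicator (s : Finset ℤ) (i : ℤ) : ℤ := if i ∈ s then 1 else 0

theorem height_nonneg (a : Config) (i : ℤ) : 0 ≤ height a i := Int.natCast_nonneg _

theorem eq_of_height_eq {a b : Config} (h : ∀ i, height a i = height b i) : a = b :=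
  Finsupp.ext fun i => Int.ofNat_inj.1 (h i)

theorem indicator_cases (s : Finset ℤ) (i : ℤ) :
    (indicator s i = 1 ∧ i ∈ s) ∨ (indicator s i = 0 ∧ i ∉ s) := by
  unfold indicator
  split_ifs with h <;> simp [h]

theorem prefixSum_eq_add (a : Config) (i : ℤ) :
    prefixSum a i = prefixSum a (i - 1) + height a i := by
  have : ∀ j : ℤ, (if j ≤ i then (a j : ℤ) else 0) =
      (if j ≤ i - 1 then (a j : ℤ) else 0) + if j = i then (a j : ℤ) else 0 := by
    intro j
    split_ifs <;> omega
  unfold prefixSum height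
  rw [Finsupp.sum, Finset.sum_congr rfl fun j _ => this j, Finset.sum_add_distrib, Finsupp.sum]
  congr 1
  rw [Finset.sum_ite_eq']
  split_ifs with h
  · rfl
  · simp [Finsupp.notMem_support_iff.1 h]

theorem height_eq_sub (a : Config) (i : ℤ) :
    height a i = prefixSum a i - prefixSum a (i - 1) := by
  rw [prefixSum_eq_add a i]
  ring

/-- Outside of a bounded interval the prefix sums of `a` are `0` and `total a`. -/
theorem exists_bound (a : Config) :
    ∃ N : ℤ, 0 ≤ N ∧ (∀ i < -N, prefixSum a i = 0) ∧ ∀ i > N, prefixSum a i = total a := by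
  refine ⟨((a.support.sup Int.natAbs : ℕ) : ℤ), by positivity, fun i hi => ?_, fun i hi => ?_⟩
  · refine Finset.sum_eq_zero fun j hj => if_neg ?_
    have := Finset.le_sup (f := Int.natAbs) hj
    omega
  · refine Finset.sum_congr rfl fun j hj => if_pos ?_
    have := Finset.le_sup (f := Int.natAbs) hj
    omega

theorem exists_indicator_bound (s : Finset ℤ) :
    ∃ K : ℤ, 0 ≤ K ∧ ∀ i, i < -K ∨ K < i → indicator s i = 0 := by
  refine ⟨((s.sup Int.natAbs : ℕ) : ℤ), by positivity, fun i hi => if_neg fun hmem => ?_⟩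
  have := Finset.le_sup (f := Int.natAbs) hmem
  omega

theorem eq_of_sub_eq {f g : ℤ → ℤ} (h : ∀ i, f i - f (i - 1) = g i - g (i - 1)) {N : ℤ}
    (hN : f N = g N) (i : ℤ) : f i = g i := by
  induction i using Int.inductionOn' (b := N) with
  | zero => exact hN
  | succ k _ ih =>
    have := h (k + 1)
    rw [add_sub_cancel_right] at this
    omega
  | pred k _ ih =>
    have := h k
    omega

/-- `b` arises from `a` by the simultaneous application of the left rule on the columns in `L` and
of the right rule on the columns in `R`, where other columns may be able to move as well. -/
structure LegalMove (a b : Config) (L R : Finset ℤ) : Prop where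
  canLeft : ∀ i ∈ L, CanLeft a i
  canRight : ∀ i ∈ R, CanRight a i
  disjoint : Disjoint L R
  eq : ∀ i, b i + (if i ∈ L ∪ R then 1 else 0)
      = a i + (if i + 1 ∈ L then 1 else 0) + (if i - 1 ∈ R then 1 else 0)

theorem canLeft_iff {a : Config} {i : ℤ} :
    CanLeft a i ↔ height a (i - 1) + 2 ≤ height a i := by
  unfold CanLeft height
  omega

theorem canRight_iff {a : Config} {i : ℤ} :
    CanRight a i ↔ height a (i + 1) + 2 ≤ height a i := by
  unfold CanRight height
  omega

theorem LegalMove.fires {a b : Config} {L R : Finset ℤ} (h : LegalMove a b L R) :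
    Fires (height a) (height b) (indicator L) (indicator R) where
  nonneg := height_nonneg a
  left i := by
    rcases indicator_cases L i with ⟨h1, h2⟩ | ⟨h1, -⟩
    · exact Or.inr ⟨h1, canLeft_iff.1 (h.canLeft i h2)⟩
    · exact Or.inl h1
  right i := by
    rcases indicator_cases R i with ⟨h1, h2⟩ | ⟨h1, -⟩
    · exact Or.inr ⟨h1, canRight_iff.1 (h.canRight i h2)⟩
    · exact Or.inl h1
  disj i := by
    have h2 : i ∈ L → i ∉ R := fun h0 => Finset.disjoint_left.1 h.disjoint h0
    unfold indicator
    split_ifs <;> simp_all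
  eq i := by
    have h1 := h.eq i
    have h2 : i ∈ L → i ∉ R := fun h0 => Finset.disjoint_left.1 h.disjoint h0
    unfold indicator height
    simp only [Finset.mem_union] at h1
    by_cases hL : i ∈ L <;> by_cases hR : i ∈ R
    · exact absurd hR (h2 hL)
    all_goals
      simp only [hL, hR, or_true, or_false, or_self, if_true, if_false] at h1 ⊢
      split_ifs at h1 ⊢ <;> omega

theorem LegalMove.prefixSum_eq {a b : Config} {L R : Finset ℤ} (h : LegalMove a b L R) (i : ℤ) :
    prefixSum b i = prefixSum a i + indicator L (i + 1) - indicator R i := by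
  obtain ⟨N, n1, hN, -⟩ := exists_bound a
  obtain ⟨M, n2, hM, -⟩ := exists_bound b
  obtain ⟨K, n3, hK⟩ := exists_indicator_bound L
  obtain ⟨J, n4, hJ⟩ := exists_indicator_bound R
  refine eq_of_sub_eq (g := fun i => prefixSum a i + indicator L (i + 1) - indicator R i)
    (fun j => ?_) (N := -(N + M + K + J) - 2) ?_ i
  · have h1 := h.fires.eq j
    rw [height_eq_sub, height_eq_sub] at h1
    simp only [sub_add_cancel]
    omega
  · rw [hN _ (by omega), hM _ (by omega), hK _ (by omega), hJ _ (by omega)]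
    rfl

theorem LegalMove.total_eq {a b : Config} {L R : Finset ℤ} (h : LegalMove a b L R) :
    total b = total a := by
  obtain ⟨N, n1, -, hN⟩ := exists_bound a
  obtain ⟨M, n2, -, hM⟩ := exists_bound b
  obtain ⟨K, n3, hK⟩ := exists_indicator_bound L
  obtain ⟨J, n4, hJ⟩ := exists_indicator_bound R
  have h1 := h.prefixSum_eq (N + M + K + J + 1)
  rw [hN _ (by omega), hM _ (by omega), hK _ (by omega), hJ _ (by omega)] at h1
  omega

theorem exists_legalMove {a : Config} {L R : Finset ℤ} (hL : ∀ i ∈ L, CanLeft a i)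
    (hR : ∀ i ∈ R, CanRight a i) (hd : Disjoint L R) : ∃ b, LegalMove a b L R := by
  classical
  let f : ℤ → ℕ := fun i => a i + (if i + 1 ∈ L then 1 else 0) + (if i - 1 ∈ R then 1 else 0)
    - (if i ∈ L ∪ R then 1 else 0)
  refine ⟨Finsupp.onFinset (a.support ∪ L.image (· - 1) ∪ R.image (· + 1)) f fun i hi => ?_,
    hL, hR, hd, fun i => ?_⟩
  · by_contra hne
    simp only [Finset.mem_union, Finset.mem_image, not_or, not_exists, not_and,
      Finsupp.notMem_support_iff] at hne
    have h1 : i + 1 ∉ L := fun h => hne.1.2 _ h (by ring)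
    have h2 : i - 1 ∉ R := fun h => hne.2 _ h (by ring)
    simp [f, hne.1.1, h1, h2] at hi
  · have : i ∈ L ∪ R → 2 ≤ a i := fun h => by
      rcases Finset.mem_union.1 h with h | h
      · have := hL i h
        unfold CanLeft at this
        omega
      · have := hR i h
        unfold CanRight at this
        omega
    simp only [Finsupp.onFinset_apply, f]
    by_cases h : i ∈ L ∪ R
    · have := this h
      rw [if_pos h]
      omega
    · rw [if_neg h]
      omega

theorem parStep_iff {a b : Config} :
    ParStep a b ↔ ∃ L R, LegalMove a b L R ∧ (∀ i, CanLeft a i ∨ CanRight a i → i ∈ L ∪ R) ∧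
      (L ∪ R).Nonempty :=
  ⟨fun ⟨L, R, h1, h2, h3, h4, h5, h6⟩ => ⟨L, R, ⟨h1, h2, h3, h6⟩, h4, h5⟩,
    fun ⟨L, R, ⟨h1, h2, h3, h6⟩, h4, h5⟩ => ⟨L, R, h1, h2, h3, h4, h5, h6⟩⟩

theorem LegalMove.ext {a b b' : Config} {L R : Finset ℤ} (h : LegalMove a b L R)
    (h' : LegalMove a b' L R) : b = b' :=
  eq_of_height_eq fun i => by rw [h.fires.eq, h'.fires.eq]

theorem LegalMove.of_fires {a b : Config} {L R : Finset ℤ}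
    (h : Fires (height a) (height b) (indicator L) (indicator R)) : LegalMove a b L R := by
  have hL : ∀ i ∈ L, CanLeft a i := fun i hi => by
    have := h.left i
    rw [canLeft_iff]
    rcases indicator_cases L i with h1 | h1
    · omega
    · exact absurd hi h1.2
  have hR : ∀ i ∈ R, CanRight a i := fun i hi => by
    have := h.right i
    rw [canRight_iff]
    rcases indicator_cases R i with h1 | h1
    · omega
    · exact absurd hi h1.2
  have hd : Disjoint L R := Finset.disjoint_left.2 fun i h1 h2 => by
    have := h.disj i
    simp [indicator, h1, h2] at this
  obtain ⟨b', hb'⟩ := exists_legalMove hL hR hd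
  have : b' = b := eq_of_height_eq fun i => by rw [hb'.fires.eq, h.eq]
  rwa [this] at hb'

end SandPile

/-! ### Parallel transitions as sequences of single moves -/

namespace SandPile

theorem Split.no_valley {c : ℤ → ℤ} {p : ℤ} (h : Split c p) (hc : ∀ i, 0 ≤ c i) (i : ℤ) :
    c (i - 1) ≤ c i ∨ c (i + 1) ≤ c i := by
  rcases le_or_gt i p with hi | hi
  · by_cases h0 : 0 < c (i - 1)
    · have := h.1 (i - 1) i (by omega) hi h0
      omega
    · have := hc i
      omega
  · by_cases h0 : 0 < c (i + 1)
    · have := h.2 i (i + 1) hi (by omega) h0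
      omega
    · have := hc i
      omega

/-- On a configuration without valleys, simultaneous moves can be performed in two portions. -/
theorem Fires.rest {c c' c₁ l r l₀ r₀ : ℤ → ℤ} {p : ℤ} (h : Fires c c' l r) (hs : Split c p)
    (h₀ : Fires c c₁ l₀ r₀) (hl : ∀ i, l₀ i ≤ l i) (hr : ∀ i, r₀ i ≤ r i) :
    Fires c₁ c' (fun i => l i - l₀ i) (fun i => r i - r₀ i) where
  nonneg i := by
    have e := h₀.eq i
    have a1 := h₀.left i
    have a2 := h₀.left (i + 1)
    have a3 := h₀.right i
    have a4 := h₀.right (i - 1)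
    have a5 := h₀.disj i
    have n0 := h₀.nonneg i
    have n1 := h₀.nonneg (i - 1)
    have n2 := h₀.nonneg (i + 1)
    omega
  left i := by
    have e := h₀.eq i
    have e' := h₀.eq (i - 1)
    rw [sub_add_cancel, show i - 1 - 1 = i - 2 by ring] at e'
    have v := hs.no_valley h.nonneg (i - 1)
    rw [sub_add_cancel, show i - 1 - 1 = i - 2 by ring] at v
    have a0 := hl i
    have a1 := h.left i
    have a2 := h₀.left i
    have a3 := h₀.left (i + 1)
    have a4 := h₀.left (i - 1)
    have a5 := h₀.right i
    have a6 := h₀.right (i - 1)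
    have a7 := h₀.right (i - 2)
    rw [show i - 2 + 1 = i - 1 by ring] at a7
    have a8 := h.disj i
    have a9 := hr i
    have b1 := h.right i
    omega
  right i := by
    have e := h₀.eq i
    have e' := h₀.eq (i + 1)
    rw [add_sub_cancel_right, show i + 1 + 1 = i + 2 by ring] at e'
    have v := hs.no_valley h.nonneg (i + 1)
    rw [add_sub_cancel_right, show i + 1 + 1 = i + 2 by ring] at v
    have a0 := hr i
    have a1 := h.right i
    have a2 := h₀.right i
    have a3 := h₀.right (i - 1)
    have a4 := h₀.right (i + 1)
    have a5 := h₀.left i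
    have a6 := h₀.left (i + 1)
    have a7 := h₀.left (i + 2)
    rw [show i + 2 - 1 = i + 1 by ring] at a7
    have a8 := h.disj i
    have a9 := hl i
    have b1 := h.left i
    omega
  disj i := by
    have := h.disj i
    have := h₀.left i
    have := h₀.right i
    omega
  eq i := by
    rw [h.eq i, h₀.eq i]
    ring

theorem indicator_erase {s : Finset ℤ} {i : ℤ} (hi : i ∈ s) :
    indicator (s.erase i) = fun j => indicator s j - indicator {i} j := by
  funext j
  unfold indicator
  by_cases h : j = i
  · subst h
    simp [hi]
  · simp [h]

theorem indicator_singleton_le {s : Finset ℤ} {i : ℤ} (hi : i ∈ s) (j : ℤ) :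
    indicator {i} j ≤ indicator s j := by
  unfold indicator
  by_cases h : j = i
  · subst h
    simp [hi]
  · simp only [Finset.mem_singleton, h, if_false]
    split_ifs <;> omega

theorem indicator_empty : indicator ∅ = fun _ => 0 := by
  funext j
  simp [indicator]

theorem indicator_nonneg (s : Finset ℤ) (j : ℤ) : 0 ≤ indicator s j := by
  unfold indicator
  split_ifs <;> omega

theorem legalMove_left_iff {a b : Config} {i : ℤ} : LegalMove a b {i} ∅ ↔
    CanLeft a i ∧ b + Finsupp.single i 1 = a + Finsupp.single (i - 1) 1 := by
  constructor
  · intro h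
    refine ⟨h.canLeft i (by simp), Finsupp.ext fun j => ?_⟩
    have := h.eq j
    simp only [Finset.mem_union, Finset.mem_singleton, Finset.notMem_empty, or_false,
      if_false] at this
    simp only [Finsupp.add_apply, Finsupp.single_apply]
    split_ifs at this ⊢ <;> omega
  · rintro ⟨h1, h2⟩
    refine ⟨by simpa using h1, by simp, by simp, fun j => ?_⟩
    have := DFunLike.congr_fun h2 j
    simp only [Finsupp.add_apply, Finsupp.single_apply] at this
    simp only [Finset.mem_union, Finset.mem_singleton, Finset.notMem_empty, or_false, if_false]
    split_ifs at this ⊢ <;> omega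

theorem legalMove_right_iff {a b : Config} {i : ℤ} : LegalMove a b ∅ {i} ↔
    CanRight a i ∧ b + Finsupp.single i 1 = a + Finsupp.single (i + 1) 1 := by
  constructor
  · intro h
    refine ⟨h.canRight i (by simp), Finsupp.ext fun j => ?_⟩
    have := h.eq j
    simp only [Finset.mem_union, Finset.mem_singleton, Finset.notMem_empty, false_or,
      if_false] at this
    simp only [Finsupp.add_apply, Finsupp.single_apply]
    split_ifs at this ⊢ <;> omega
  · rintro ⟨h1, h2⟩
    refine ⟨by simp, by simpa using h1, by simp, fun j => ?_⟩
    have := DFunLike.congr_fun h2 j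
    simp only [Finsupp.add_apply, Finsupp.single_apply] at this
    simp only [Finset.mem_union, Finset.mem_singleton, Finset.notMem_empty, false_or, if_false]
    split_ifs at this ⊢ <;> omega

theorem seqStep_iff {a b : Config} :
    SeqStep a b ↔ ∃ i, LegalMove a b {i} ∅ ∨ LegalMove a b ∅ {i} := by
  simp only [legalMove_left_iff, legalMove_right_iff]
  rfl

/-- Some split exists; all configurations reachable from a single column have this property. -/
def HasSplit (a : Config) : Prop := ∃ p, Split (height a) p

theorem LegalMove.hasSplit {a b : Config} {L R : Finset ℤ} (h : LegalMove a b L R)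
    (ha : HasSplit a) : HasSplit b :=
  ha.elim fun _ hp => h.fires.exists_split hp

theorem SeqStep.hasSplit {a b : Config} (h : SeqStep a b) (ha : HasSplit a) : HasSplit b := by
  obtain ⟨i, h | h⟩ := seqStep_iff.1 h <;> exact h.hasSplit ha

theorem SeqStep.total_eq {a b : Config} (h : SeqStep a b) : total b = total a := by
  obtain ⟨i, h | h⟩ := seqStep_iff.1 h <;> exact h.total_eq

theorem LegalMove.exists_first_left {a b : Config} {L R : Finset ℤ} (h : LegalMove a b L R)
    (ha : HasSplit a) {i : ℤ} (hi : i ∈ L) :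
    ∃ d, LegalMove a d {i} ∅ ∧ LegalMove d b (L.erase i) R := by
  obtain ⟨p, hp⟩ := ha
  obtain ⟨d, hd⟩ := exists_legalMove (a := a) (L := {i}) (R := ∅)
    (by simpa using h.canLeft i hi) (by simp) (by simp)
  refine ⟨d, hd, .of_fires ?_⟩
  have := h.fires.rest hp hd.fires (indicator_singleton_le hi)
    (fun j => by rw [indicator_empty]; exact indicator_nonneg R j)
  rw [indicator_erase hi]
  simpa only [indicator_empty, sub_zero] using this

theorem LegalMove.exists_first_right {a b : Config} {L R : Finset ℤ} (h : LegalMove a b L R)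
    (ha : HasSplit a) {i : ℤ} (hi : i ∈ R) :
    ∃ d, LegalMove a d ∅ {i} ∧ LegalMove d b L (R.erase i) := by
  obtain ⟨p, hp⟩ := ha
  obtain ⟨d, hd⟩ := exists_legalMove (a := a) (L := ∅) (R := {i})
    (by simp) (by simpa using h.canRight i hi) (by simp)
  refine ⟨d, hd, .of_fires ?_⟩
  have := h.fires.rest hp hd.fires
    (fun j => by rw [indicator_empty]; exact indicator_nonneg L j) (indicator_singleton_le hi)
  rw [indicator_erase hi]
  simpa only [indicator_empty, sub_zero] using this

theorem LegalMove.reflTransGen {a b : Config} {L R : Finset ℤ} (h : LegalMove a b L R)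
    (ha : HasSplit a) : Relation.ReflTransGen SeqStep a b := by
  induction hn : L.card + R.card generalizing a L R with
  | zero =>
    obtain rfl : L = ∅ := Finset.card_eq_zero.1 (by omega)
    obtain rfl : R = ∅ := Finset.card_eq_zero.1 (by omega)
    have : b = a := eq_of_height_eq fun i => by
      rw [h.fires.eq]
      simp [indicator]
    rw [this]
  | succ n ih =>
    rcases L.eq_empty_or_nonempty with rfl | ⟨i, hi⟩
    · obtain ⟨i, hi⟩ : R.Nonempty := Finset.card_pos.1 (by simp at hn; omega)
      obtain ⟨d, h1, h2⟩ := h.exists_first_right ha hi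
      refine .head (seqStep_iff.2 ⟨i, Or.inr h1⟩) (ih h2 (h1.hasSplit ha) ?_)
      rw [Finset.card_erase_of_mem hi]
      have := Finset.card_pos.2 ⟨i, hi⟩
      omega
    · obtain ⟨d, h1, h2⟩ := h.exists_first_left ha hi
      refine .head (seqStep_iff.2 ⟨i, Or.inl h1⟩) (ih h2 (h1.hasSplit ha) ?_)
      rw [Finset.card_erase_of_mem hi]
      have := Finset.card_pos.2 ⟨i, hi⟩
      omega

/-! ### Termination -/

/-- The sum of the squares of the heights; it decreases with every move of a single grain. -/
noncomputable def energy (a : Config) : ℕ := a.sum fun _ v => v ^ 2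

theorem energy_add_single (d : Config) (i : ℤ) :
    energy (d + Finsupp.single i 1) = energy d + 2 * d i + 1 := by
  classical
  have h1 : energy (d + Finsupp.single i 1)
      = ∑ j ∈ insert i d.support, (d + Finsupp.single i 1 : Config) j ^ 2 := by
    refine Finsupp.sum_of_support_subset _ ?_ _ (by simp)
    refine Finsupp.support_add.trans (Finset.union_subset (Finset.subset_insert _ _) ?_)
    exact Finsupp.support_single_subset.trans (by simp)
  have h2 : energy d = ∑ j ∈ insert i d.support, d j ^ 2 :=
    Finsupp.sum_of_support_subset _ (Finset.subset_insert _ _) _ (by simp)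
  have h3 : ∀ j, (d + Finsupp.single i 1 : Config) j ^ 2
      = d j ^ 2 + if j = i then 2 * d j + 1 else 0 := by
    intro j
    rw [Finsupp.add_apply, Finsupp.single_apply]
    split_ifs with e1 e2 e2
    · ring
    · exact absurd e1.symm e2
    · exact absurd e2.symm e1
    · ring
  rw [h1, h2, Finset.sum_congr rfl fun j _ => h3 j, Finset.sum_add_distrib, Finset.sum_ite_eq']
  simp
  ring

theorem energy_lt_of_move {a b : Config} {i k : ℤ} (hik : k ≠ i) (h : a k + 2 ≤ a i)
    (he : b + Finsupp.single i 1 = a + Finsupp.single k 1) : energy b < energy a := by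
  have ha : a = (a - Finsupp.single i 1) + Finsupp.single i 1 := by
    refine (tsub_add_cancel_of_le ?_).symm
    rw [Finsupp.single_le_iff]
    omega
  set d := a - Finsupp.single i 1 with hd
  have hb : b = d + Finsupp.single k 1 := by
    rw [ha, add_right_comm] at he
    exact add_right_cancel he
  have h1 : d k = a k := by simp [hd, hik.symm]
  have h2 : d i = a i - 1 := by simp [hd]
  rw [hb, ha, energy_add_single, energy_add_single]
  omega

theorem SeqStep.energy_lt {a b : Config} (h : SeqStep a b) : energy b < energy a := by
  obtain ⟨i, ⟨h1, h2⟩ | ⟨h1, h2⟩⟩ := h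
  · exact energy_lt_of_move (by omega) h1 h2
  · exact energy_lt_of_move (by omega) h1 h2

theorem energy_le_of_reflTransGen {a b : Config} (h : Relation.ReflTransGen SeqStep a b) :
    energy b ≤ energy a := by
  induction h with
  | refl => exact le_rfl
  | tail _ h ih => exact h.energy_lt.le.trans ih

theorem LegalMove.energy_lt {a b : Config} {L R : Finset ℤ} (h : LegalMove a b L R)
    (ha : HasSplit a) (hne : (L ∪ R).Nonempty) : energy b < energy a := by
  obtain ⟨i, hi⟩ := hne
  rcases Finset.mem_union.1 hi with hi | hi
  · obtain ⟨d, h1, h2⟩ := h.exists_first_left ha hi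
    exact (energy_le_of_reflTransGen (h2.reflTransGen (h1.hasSplit ha))).trans_lt
      (SeqStep.energy_lt (seqStep_iff.2 ⟨i, Or.inl h1⟩))
  · obtain ⟨d, h1, h2⟩ := h.exists_first_right ha hi
    exact (energy_le_of_reflTransGen (h2.reflTransGen (h1.hasSplit ha))).trans_lt
      (SeqStep.energy_lt (seqStep_iff.2 ⟨i, Or.inr h1⟩))

end SandPile

/-! ### Monotonicity of the parallel dynamics -/

namespace SandPile

/-- A parallel transition, or the identity on a configuration on which nothing can move. -/
def ParMove (a b : Config) : Prop :=
  ∃ L R, LegalMove a b L R ∧ ∀ i, CanLeft a i ∨ CanRight a i → i ∈ L ∪ R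

/-- The prefix sums of `b` exceed those of `a` by `0` or `1`. -/
def Near (a b : Config) : Prop :=
  ∀ i, prefixSum a i ≤ prefixSum b i ∧ prefixSum b i ≤ prefixSum a i + 1

/-- The prefix sums of `b` exceed those of `a` by `0` or `1`, and some split is common to
both configurations. -/
def Edge (a b : Config) : Prop :=
  Near a b ∧ ∃ p, Split (height a) p ∧ Split (height b) p

theorem indicator_le {s t : Finset ℤ} {i j : ℤ} (h : i ∈ s → j ∈ t) :
    indicator s i ≤ indicator t j := by
  rcases indicator_cases s i with ⟨e1, m1⟩ | ⟨e1, m1⟩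
  · rw [e1, indicator, if_pos (h m1)]
  · rw [e1]
    exact indicator_nonneg t j

theorem Near.refl (a : Config) : Near a a := fun _ => ⟨le_rfl, by omega⟩

theorem ParMove.hasSplit {a b : Config} (h : ParMove a b) (ha : HasSplit a) : HasSplit b :=
  let ⟨_, _, h, _⟩ := h
  h.hasSplit ha

/-- Both rules apply at most on the two columns next to the split. -/
theorem eq_or_eq_of_canLeft_of_canRight {a : Config} {p : ℤ} (h : Split (height a) p) {i : ℤ}
    (hl : CanLeft a i) (hr : CanRight a i) : i = p ∨ i = p + 1 := by
  rw [canLeft_iff] at hl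
  rw [canRight_iff] at hr
  have n1 := height_nonneg a (i - 1)
  by_contra! hne
  rcases le_or_gt i p with hi | hi
  · have := h.1 i (i + 1) (by omega) (by omega) (by omega)
    omega
  · have := h.2 (i - 1) i (by omega) (by omega) (by omega)
    omega

theorem Near.height_le {a b : Config} (h : Near a b) (i : ℤ) :
    height a i ≤ height b i + 1 ∧ height b i ≤ height a i + 1 := by
  have h1 := h i
  have h2 := h (i - 1)
  have e1 := height_eq_sub a i
  have e2 := height_eq_sub b i
  omega

/-- The column with a choice between both rules is the same for configurations joined by an edge;
in particular, it is unique. -/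
theorem Edge.choice_unique {a b : Config} (h : Edge a b) {i j : ℤ}
    (hl : CanLeft a i) (hr : CanRight a i) (hl' : CanLeft b j) (hr' : CanRight b j) : i = j := by
  obtain ⟨hn, p, ha, hb⟩ := h
  have h1 := eq_or_eq_of_canLeft_of_canRight ha hl hr
  have h2 := eq_or_eq_of_canLeft_of_canRight hb hl' hr'
  rw [canLeft_iff] at hl hl'
  rw [canRight_iff] at hr hr'
  have n1 := hn.height_le i
  have n2 := hn.height_le j
  rcases h1 with rfl | rfl <;> rcases h2 with rfl | rfl
  · rfl
  · rw [add_sub_cancel_right] at hl'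
    omega
  · rw [add_sub_cancel_right] at hl
    omega
  · rfl

theorem HasSplit.edge_self {a : Config} (h : HasSplit a) : Edge a a :=
  ⟨.refl a, h.imp fun _ hp => ⟨hp, hp⟩⟩

/-- Two parallel moves of the same configuration differ at most in the choice at the peak. -/
theorem near_of_choice {a b b' : Config} {L R L' R' : Finset ℤ} (ha : HasSplit a)
    (h : LegalMove a b L R) (hc : ∀ i, CanLeft a i ∨ CanRight a i → i ∈ L ∪ R)
    (h' : LegalMove a b' L' R') (hc' : ∀ i, CanLeft a i ∨ CanRight a i → i ∈ L' ∪ R')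
    {i : ℤ} (hi : i ∈ L) (hi' : i ∈ R') : Near b' b := by
  have hother : ∀ j, j ≠ i → indicator L j = indicator L' j ∧ indicator R j = indicator R' j := by
    intro j hj
    have hnot : ¬ (CanLeft a j ∧ CanRight a j) := fun ⟨h1, h2⟩ =>
      hj (ha.edge_self.choice_unique h1 h2 (h.canLeft i hi) (h'.canRight i hi'))
    have c1 := hc j
    have c2 := hc' j
    have d1 := h.canLeft j
    have d2 := h.canRight j
    have d3 := h'.canLeft j
    have d4 := h'.canRight j
    rw [Finset.mem_union] at c1 c2
    constructor
    · have : j ∈ L ↔ j ∈ L' := by tauto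
      simp only [indicator, this]
    · have : j ∈ R ↔ j ∈ R' := by tauto
      simp only [indicator, this]
  have e1 : indicator L i = 1 := if_pos hi
  have e2 : indicator R' i = 1 := if_pos hi'
  have e3 : indicator R i = 0 := if_neg (Finset.disjoint_left.1 h.disjoint hi)
  have e4 : indicator L' i = 0 := if_neg (Finset.disjoint_right.1 h'.disjoint hi')
  intro j
  rw [h.prefixSum_eq, h'.prefixSum_eq]
  rcases eq_or_ne j i with rfl | h1
  · have := hother (j + 1) (by omega)
    omega
  · have := hother j h1
    rcases eq_or_ne (j + 1) i with rfl | h2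
    · omega
    · have := hother (j + 1) h2
      omega

theorem ParMove.near_or_near {a b b' : Config} (ha : HasSplit a) (h : ParMove a b)
    (h' : ParMove a b') : Near b b' ∨ Near b' b := by
  obtain ⟨L, R, h, hc⟩ := h
  obtain ⟨L', R', h', hc'⟩ := h'
  by_cases h1 : ∃ i, i ∈ L ∧ i ∈ R'
  · obtain ⟨i, hi, hi'⟩ := h1
    exact Or.inr (near_of_choice ha h hc h' hc' hi hi')
  by_cases h2 : ∃ i, i ∈ L' ∧ i ∈ R
  · obtain ⟨i, hi, hi'⟩ := h2
    exact Or.inl (near_of_choice ha h' hc' h hc hi hi')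
  push Not at h1 h2
  have key : ∀ j, (j ∈ L ↔ j ∈ L') ∧ (j ∈ R ↔ j ∈ R') := fun j =>
    ⟨⟨fun hj => (Finset.mem_union.1 (hc' j (.inl (h.canLeft j hj)))).resolve_right (h1 j hj),
      fun hj => (Finset.mem_union.1 (hc j (.inl (h'.canLeft j hj)))).resolve_right (h2 j hj)⟩,
    fun hj => (Finset.mem_union.1 (hc' j (.inr (h.canRight j hj)))).resolve_left
        fun hj' => h2 j hj' hj,
      fun hj => (Finset.mem_union.1 (hc j (.inr (h'.canRight j hj)))).resolve_left
        fun hj' => h1 j hj' hj⟩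
  obtain rfl : L = L' := Finset.ext fun j => (key j).1
  obtain rfl : R = R' := Finset.ext fun j => (key j).2
  rw [h.ext h']
  exact Or.inl (.refl b')

/-- The parallel move with a prescribed choice on the columns on which both rules apply: the left
rule if `x` holds and the right rule otherwise. -/
theorem exists_parMove (a : Config) (x : Prop) [Decidable x] :
    ∃ L R b, LegalMove a b L R ∧ (∀ i, CanLeft a i ∨ CanRight a i → i ∈ L ∪ R) ∧
      (∀ i, i ∈ L ↔ CanLeft a i ∧ (x ∨ ¬ CanRight a i)) ∧
      ∀ i, i ∈ R ↔ CanRight a i ∧ (¬ x ∨ ¬ CanLeft a i) := by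
  classical
  have hL : ∀ i, i ∈ a.support.filter (fun i => CanLeft a i ∧ (x ∨ ¬ CanRight a i)) ↔
      CanLeft a i ∧ (x ∨ ¬ CanRight a i) := fun i => by
    rw [Finset.mem_filter, Finsupp.mem_support_iff, and_iff_right_iff_imp]
    rintro ⟨h, -⟩
    unfold CanLeft at h
    omega
  have hR : ∀ i, i ∈ a.support.filter (fun i => CanRight a i ∧ (¬ x ∨ ¬ CanLeft a i)) ↔
      CanRight a i ∧ (¬ x ∨ ¬ CanLeft a i) := fun i => by
    rw [Finset.mem_filter, Finsupp.mem_support_iff, and_iff_right_iff_imp]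
    rintro ⟨h, -⟩
    unfold CanRight at h
    omega
  obtain ⟨b, hb⟩ := exists_legalMove (fun i hi => ((hL i).1 hi).1) (fun i hi => ((hR i).1 hi).1)
    (Finset.disjoint_left.2 fun i h1 h2 => by
      rw [hL] at h1
      rw [hR] at h2
      tauto)
  refine ⟨_, _, b, hb, fun i hi => ?_, hL, hR⟩
  rw [Finset.mem_union, hL, hR]
  tauto

/-- Configurations joined by an edge have successors whose prefix sums still differ by at most
one. Where nothing is to be chosen, this is the monotonicity of the dynamics of the prefix sums:
`F i` increases if the second difference of `F` is at least `2`, and decreases if it is at most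
`-2`. -/
theorem Edge.exists_near {a b : Config} (h : Edge a b) :
    ∃ a' b', ParMove a a' ∧ ParMove b b' ∧ Near a' b' := by
  classical
  -- At its peak, `a` follows `b`, and so does `b` follow `a` unless `a` has the choice as well.
  obtain ⟨x, hx⟩ : ∃ x : Prop, ∀ k, CanLeft a k → CanRight a k → (x ↔ CanLeft b k) := by
    refine ⟨∃ k, CanLeft a k ∧ CanRight a k ∧ CanLeft b k, fun k h1 h2 => ?_⟩
    refine ⟨fun ⟨j, h3, h4, h5⟩ => ?_, fun h3 => ⟨k, h1, h2, h3⟩⟩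
    have ha : Edge a a := ⟨.refl a, h.2.imp fun _ hp => ⟨hp.1, hp.1⟩⟩
    rwa [ha.choice_unique h1 h2 h3 h4]
  obtain ⟨y, hy⟩ : ∃ y : Prop, ∀ k, CanLeft b k → CanRight b k →
      (y ↔ (CanRight a k → CanLeft a k)) := by
    refine ⟨∃ k, CanLeft b k ∧ CanRight b k ∧ (CanRight a k → CanLeft a k), fun k h1 h2 => ?_⟩
    refine ⟨fun ⟨j, h3, h4, h5⟩ => ?_, fun h3 => ⟨k, h1, h2, h3⟩⟩
    have hb : Edge b b := ⟨.refl b, h.2.imp fun _ hp => ⟨hp.2, hp.2⟩⟩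
    rwa [hb.choice_unique h1 h2 h3 h4]
  obtain ⟨L, R, a', ha', hca, hL, hR⟩ := exists_parMove a x
  obtain ⟨L', R', b', hb', hcb, hL', hR'⟩ := exists_parMove b y
  refine ⟨a', b', ⟨L, R, ha', hca⟩, ⟨L', R', hb', hcb⟩, fun k => ?_⟩
  rw [ha'.prefixSum_eq, hb'.prefixSum_eq]
  have hx0 := hx k
  have hx1 := hx (k + 1)
  have hy0 := hy k
  have hy1 := hy (k + 1)
  have l1 := hL (k + 1)
  have r1 := hR k
  have l2 := hL' (k + 1)
  have r2 := hR' k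
  have n0 := h.1 (k - 1)
  have n1 := h.1 k
  have n2 := h.1 (k + 1)
  have cla : CanLeft a (k + 1) ↔ _ := canLeft_iff
  have clb : CanLeft b (k + 1) ↔ _ := canLeft_iff
  have cra : CanRight a k ↔ _ := canRight_iff
  have crb : CanRight b k ↔ _ := canRight_iff
  simp only [height_eq_sub, add_sub_cancel_right] at cla clb cra crb
  rcases (show prefixSum b k = prefixSum a k ∨ prefixSum b k = prefixSum a k + 1 by omega) with
    heq | heq
  · have h1 : CanLeft a (k + 1) → CanLeft b (k + 1) := by rw [cla, clb]; omega
    have h2 : CanRight b k → CanRight a k := by rw [cra, crb]; omega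
    have h4 : CanLeft b (k + 1) → ¬ CanRight a k := by rw [clb, cra]; omega
    have i1 : indicator L (k + 1) ≤ indicator L' (k + 1) := indicator_le fun h => by
      rw [l1] at h
      rw [l2]
      refine ⟨h1 h.1, ?_⟩
      by_contra! hne
      exact hne.1 ((hy1 (h1 h.1) hne.2).2 fun _ => h.1)
    have i2 : indicator R' k ≤ indicator R k := indicator_le fun h => by
      rw [r2] at h
      rw [r1]
      refine ⟨h2 h.1, ?_⟩
      by_contra! hne
      have hb := (hx0 hne.2 (h2 h.1)).1 hne.1
      exact h.2.elim (fun hny => hny ((hy0 hb h.1).2 fun _ => hne.2)) fun hnb => hnb hb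
    have i3 : indicator L' (k + 1) + indicator R k ≤ 1 := by
      rcases indicator_cases L' (k + 1) with ⟨e1, m1⟩ | ⟨e1, m1⟩ <;>
        rcases indicator_cases R k with ⟨e2, m2⟩ | ⟨e2, m2⟩
      · exact absurd (r1.1 m2).1 (h4 (l2.1 m1).1)
      all_goals omega
    have := indicator_nonneg L (k + 1)
    have := indicator_nonneg R' k
    omega
  · have h1 : CanLeft b (k + 1) → CanLeft a (k + 1) := by rw [cla, clb]; omega
    have h2 : CanRight a k → CanRight b k := by rw [cra, crb]; omega
    have h3 : CanLeft a (k + 1) → ¬ CanRight b k := by rw [cla, crb]; omega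
    have i1 : indicator L' (k + 1) ≤ indicator L (k + 1) := indicator_le fun h => by
      rw [l2] at h
      rw [l1]
      refine ⟨h1 h.1, ?_⟩
      by_contra! hne
      exact hne.1 ((hx1 (h1 h.1) hne.2).2 h.1)
    have i2 : indicator R k ≤ indicator R' k := indicator_le fun h => by
      rw [r1] at h
      rw [r2]
      refine ⟨h2 h.1, ?_⟩
      by_contra! hne
      have ha := (hy0 hne.2 (h2 h.1)).1 hne.1 h.1
      exact h.2.elim (fun hnx => hnx ((hx0 ha h.1).2 hne.2)) fun hna => hna ha
    have i3 : indicator L (k + 1) + indicator R' k ≤ 1 := by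
      rcases indicator_cases L (k + 1) with ⟨e1, m1⟩ | ⟨e1, m1⟩ <;>
        rcases indicator_cases R' k with ⟨e2, m2⟩ | ⟨e2, m2⟩
      · exact absurd (r2.1 m2).1 (h3 (l1.1 m1).1)
      all_goals omega
    have := indicator_nonneg L' (k + 1)
    have := indicator_nonneg R k
    omega

/-- Successors of configurations joined by an edge are joined by an edge if their prefix sums
still differ by at most one. -/
theorem Edge.of_near {a b a' b' : Config} (h : Edge a b) (ha : ParMove a a') (hb : ParMove b b')
    (hn : Near a' b') : Edge a' b' := by
  refine ⟨hn, ?_⟩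
  obtain ⟨L, R, ha, -⟩ := ha
  obtain ⟨L', R', hb, -⟩ := hb
  obtain ⟨h0, p, hpa, hpb⟩ := h
  refine exists_common_split (F := fun i => prefixSum b i - prefixSum a i)
    (F' := fun i => prefixSum b' i - prefixSum a' i) (fun i => ?_) (fun i => ?_) (fun i => ?_)
    ha.fires hb.fires (fun i => ?_) hpa hpb
  · have := h0 i
    omega
  · have := hn i
    omega
  · have e1 := height_eq_sub a i
    have e2 := height_eq_sub b i
    omega
  · have e1 := ha.prefixSum_eq i
    have e2 := hb.prefixSum_eq i
    omega

end SandPile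

/-! ### The configurations reached after a given number of parallel transitions -/

namespace SandPile

/-- No rule applies on any column. -/
def Stuck (a : Config) : Prop := ∀ i, ¬ CanLeft a i ∧ ¬ CanRight a i

theorem ParMove.exists (a : Config) : ∃ b, ParMove a b :=
  let ⟨L, R, b, h, hc, _⟩ := exists_parMove a True
  ⟨b, L, R, h, hc⟩

theorem forall_not_parStep_iff {a : Config} : (∀ b, ¬ ParStep a b) ↔ Stuck a := by
  constructor
  · intro h i
    by_contra hne
    obtain ⟨b, L, R, hb, hc⟩ := ParMove.exists a
    exact h b (parStep_iff.2 ⟨L, R, hb, hc, i, hc i (by tauto)⟩)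
  · intro h b hb
    obtain ⟨L, R, hb, -, i, hi⟩ := parStep_iff.1 hb
    rcases Finset.mem_union.1 hi with hi | hi
    · exact (h i).1 (hb.canLeft i hi)
    · exact (h i).2 (hb.canRight i hi)

theorem forall_not_seqStep_iff {a : Config} : (∀ b, ¬ SeqStep a b) ↔ Stuck a := by
  constructor
  · intro h i
    refine ⟨fun hi => ?_, fun hi => ?_⟩
    · obtain ⟨b, hb⟩ := exists_legalMove (a := a) (L := {i}) (R := ∅) (by simpa) (by simp)
        (by simp)
      exact h b (seqStep_iff.2 ⟨i, Or.inl hb⟩)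
    · obtain ⟨b, hb⟩ := exists_legalMove (a := a) (L := ∅) (R := {i}) (by simp) (by simpa)
        (by simp)
      exact h b (seqStep_iff.2 ⟨i, Or.inr hb⟩)
  · rintro h b ⟨i, ⟨hi, -⟩ | ⟨hi, -⟩⟩
    · exact (h i).1 hi
    · exact (h i).2 hi

theorem Stuck.parMove_iff {a b : Config} (h : Stuck a) : ParMove a b ↔ b = a := by
  have key : LegalMove a a ∅ ∅ := ⟨by simp, by simp, by simp, by simp⟩
  constructor
  · rintro ⟨L, R, hb, -⟩
    obtain rfl : L = ∅ := Finset.eq_empty_of_forall_notMem fun i hi => (h i).1 (hb.canLeft i hi)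
    obtain rfl : R = ∅ := Finset.eq_empty_of_forall_notMem fun i hi => (h i).2 (hb.canRight i hi)
    exact hb.ext key
  · rintro rfl
    exact ⟨∅, ∅, key, fun i hi => absurd hi (by have := h i; tauto)⟩

theorem ParMove.parStep {a b : Config} (h : ParMove a b) (ha : ¬ Stuck a) : ParStep a b := by
  obtain ⟨L, R, h, hc⟩ := h
  refine parStep_iff.2 ⟨L, R, h, hc, ?_⟩
  unfold Stuck at ha
  push Not at ha
  obtain ⟨i, hi⟩ := ha
  exact ⟨i, hc i (by tauto)⟩

theorem parMove_of_parStep {a b : Config} (h : ParStep a b) : ParMove a b :=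
  let ⟨L, R, h, hc, _⟩ := parStep_iff.1 h
  ⟨L, R, h, hc⟩

theorem ParStep.energy_lt {a b : Config} (h : ParStep a b) (ha : HasSplit a) :
    energy b < energy a :=
  let ⟨_, _, h, _, hne⟩ := parStep_iff.1 h
  h.energy_lt ha hne

/-- The configurations of the parallel model after `t` transitions, where a configuration on which
no rule applies remains as it is. -/
def stage (n : ℕ) : ℕ → Set Config
  | 0 => {initial n}
  | t + 1 => {b | ∃ a ∈ stage n t, ParMove a b}

variable {n t : ℕ}

theorem hasSplit_initial (n : ℕ) : HasSplit (initial n) := by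
  refine ⟨0, fun i j hij hj hi => ?_, fun i j hi hij hj => ?_⟩
  · have : height (initial n) i = 0 := by
      simp [height, initial, show i ≠ 0 by omega]
    omega
  · have : height (initial n) j = 0 := by
      simp [height, initial, show j ≠ 0 by omega]
    omega

theorem total_initial (n : ℕ) : total (initial n) = n := by
  simp [total, initial]

theorem energy_initial (n : ℕ) : energy (initial n) = n ^ 2 := by
  simp [energy, initial]

theorem hasSplit_of_mem_stage {a : Config} (h : a ∈ stage n t) : HasSplit a := by
  induction t generalizing a with
  | zero => exact h ▸ hasSplit_initial n
  | succ t ih =>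
    obtain ⟨b, hb, hba⟩ := h
    exact hba.hasSplit (ih hb)

theorem mem_seq_reachable {a : Config} (h : a ∈ stage n t) : a ∈ reachable SeqStep n := by
  induction t generalizing a with
  | zero => exact h ▸ Relation.ReflTransGen.refl
  | succ t ih =>
    obtain ⟨b, hb, L, R, hba, -⟩ := h
    exact (ih hb).trans (hba.reflTransGen (hasSplit_of_mem_stage hb))

theorem mem_par_reachable {a : Config} (h : a ∈ stage n t) : a ∈ reachable ParStep n := by
  induction t generalizing a with
  | zero => exact h ▸ Relation.ReflTransGen.refl
  | succ t ih =>
    obtain ⟨b, hb, hba⟩ := h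
    by_cases hs : Stuck b
    · exact hs.parMove_iff.1 hba ▸ ih hb
    · exact (ih hb).tail (hba.parStep hs)

theorem hasSplit_of_reachable {a : Config} (h : a ∈ reachable SeqStep n) : HasSplit a := by
  induction h with
  | refl => exact hasSplit_initial n
  | tail _ h ih => exact h.hasSplit ih

theorem total_of_reachable {a : Config} (h : a ∈ reachable SeqStep n) : total a = n := by
  induction h with
  | refl => exact total_initial n
  | tail _ h ih => rw [h.total_eq, ih]

theorem stuck_or_energy_le {a : Config} (h : a ∈ stage n t) : Stuck a ∨ energy a + t ≤ n ^ 2 := by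
  induction t generalizing a with
  | zero => exact Or.inr (h ▸ (energy_initial n).le)
  | succ t ih =>
    obtain ⟨b, hb, hba⟩ := h
    by_cases hs : Stuck b
    · exact Or.inl (hs.parMove_iff.1 hba ▸ hs)
    · have h1 := (ih hb).resolve_left hs
      have h2 := (hba.parStep hs).energy_lt (hasSplit_of_mem_stage hb)
      exact Or.inr (by omega)

theorem exists_mem_stage {a : Config} (h : a ∈ reachable ParStep n) :
    ∃ t, energy a + t ≤ n ^ 2 ∧ a ∈ stage n t := by
  induction h with
  | refl => exact ⟨0, (energy_initial n).le, rfl⟩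
  | tail _ h ih =>
    obtain ⟨t, h1, h2⟩ := ih
    have := h.energy_lt (hasSplit_of_mem_stage h2)
    exact ⟨t + 1, by omega, _, h2, parMove_of_parStep h⟩

theorem Stuck.mem_stage_add {a : Config} (h : Stuck a) (ha : a ∈ stage n t) (k : ℕ) :
    a ∈ stage n (t + k) := by
  induction k with
  | zero => exact ha
  | succ k ih => exact ⟨a, ih, h.parMove_iff.2 rfl⟩

/-- After more than `n ^ 2` transitions exactly the fixed points are left. -/
theorem psspmFixedPoints_eq_stage (n : ℕ) : psspmFixedPoints n = stage n (n ^ 2 + 1) := by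
  ext a
  constructor
  · rintro ⟨h1, h2⟩
    obtain ⟨t, h3, h4⟩ := exists_mem_stage h1
    have := (forall_not_parStep_iff.1 h2).mem_stage_add h4 (n ^ 2 + 1 - t)
    rwa [show t + (n ^ 2 + 1 - t) = n ^ 2 + 1 by omega] at this
  · intro h
    refine ⟨mem_par_reachable h, forall_not_parStep_iff.2 ?_⟩
    exact (stuck_or_energy_le h).resolve_right (by omega)

theorem stage_nonempty (n t : ℕ) : (stage n t).Nonempty := by
  induction t with
  | zero => exact ⟨_, rfl⟩
  | succ t ih =>
    obtain ⟨a, ha⟩ := ih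
    obtain ⟨b, hb⟩ := ParMove.exists a
    exact ⟨b, a, ha, hb⟩

theorem finite_setOf_parMove (a : Config) : {b | ParMove a b}.Finite := by
  have : {b | ParMove a b} ⊆ ⋃ L ∈ a.support.powerset, ⋃ R ∈ a.support.powerset,
      {b | LegalMove a b L R} := by
    rintro b ⟨L, R, h, -⟩
    simp only [Set.mem_iUnion]
    refine ⟨L, Finset.mem_powerset.2 fun i hi => ?_, R, Finset.mem_powerset.2 fun i hi => ?_, h⟩
    · have := h.canLeft i hi
      unfold CanLeft at this
      exact Finsupp.mem_support_iff.2 (by omega)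
    · have := h.canRight i hi
      unfold CanRight at this
      exact Finsupp.mem_support_iff.2 (by omega)
  refine Set.Finite.subset ?_ this
  refine Set.Finite.biUnion (Finset.finite_toSet _) fun L _ => ?_
  refine Set.Finite.biUnion (Finset.finite_toSet _) fun R _ => ?_
  exact Set.Subsingleton.finite fun b hb b' hb' => hb.ext hb'

theorem stage_finite (n t : ℕ) : (stage n t).Finite := by
  induction t with
  | zero => exact Set.finite_singleton _
  | succ t ih =>
    have : stage n (t + 1) = ⋃ a ∈ stage n t, {b | ParMove a b} := by
      ext b
      simp [stage]
    rw [this]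
    exact ih.biUnion fun a _ => finite_setOf_parMove a

/-- Adjacency in the graph on `S` whose edges are given by `Edge`. -/
def Link (S : Set Config) (a b : Config) : Prop := a ∈ S ∧ b ∈ S ∧ (Edge a b ∨ Edge b a)

/-- The fixed number of transitions matters here: the graph of the configurations reached after
exactly `t` parallel transitions is connected. -/
theorem stage_connected {a b : Config} (ha : a ∈ stage n t) (hb : b ∈ stage n t) :
    Relation.ReflTransGen (Link (stage n t)) a b := by
  induction t generalizing a b with
  | zero =>
    obtain rfl : a = b := ha.trans hb.symm
    exact .refl
  | succ t ih =>
    -- Two successors of one configuration are linked.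
    have hself : ∀ {x y z}, x ∈ stage n t → ParMove x y → ParMove x z →
        Link (stage n (t + 1)) y z := by
      intro x y z hx hy hz
      have he := (hasSplit_of_mem_stage hx).edge_self
      refine ⟨⟨x, hx, hy⟩, ⟨x, hx, hz⟩, ?_⟩
      rcases hy.near_or_near (hasSplit_of_mem_stage hx) hz with h | h
      · exact Or.inl (he.of_near hy hz h)
      · exact Or.inr (he.of_near hz hy h)
    obtain ⟨x, hx, hxa⟩ := ha
    obtain ⟨y, hy, hyb⟩ := hb
    have hpath := ih hx hy
    clear hy
    induction hpath generalizing b with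
    | refl => exact .single (hself hx hxa hyb)
    | tail _ h ih' =>
      obtain ⟨hu, hv, h | h⟩ := h
      · obtain ⟨u', v', h1, h2, h3⟩ := h.exists_near
        refine ((ih' h1).tail ⟨⟨_, hu, h1⟩, ⟨_, hv, h2⟩, ?_⟩).tail (hself hv h2 hyb)
        exact Or.inl (h.of_near h1 h2 h3)
      · obtain ⟨v', u', h1, h2, h3⟩ := h.exists_near
        refine ((ih' h2).tail ⟨⟨_, hu, h2⟩, ⟨_, hv, h1⟩, ?_⟩).tail (hself hv h1 hyb)
        exact Or.inr (h.of_near h1 h2 h3)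

end SandPile

/-! ### The shape of the fixed points -/

namespace SandPile

/-- The staircase `h, h - 1, …, 1, 0, …` in which the height `k` is repeated; for `k = 0` no
positive height is repeated. The index is the distance `j ≥ 0` from the top. -/
def slope (h k j : ℤ) : ℤ := if j ≤ h - k then h - j else if j ≤ h then h + 1 - j else 0

/-- Twice the number of grains of `slope h k` at distance at least `j` from the top. -/
def slopeTail (h k j : ℤ) : ℤ :=
  if j ≤ h - k then (h - j) * (h - j + 1) + 2 * k
  else if j ≤ h then (h + 1 - j) * (h + 2 - j) else 0

/-- `c` consists of two staircases of almost equal heights, which meet between the columns `p`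
and `p + 1`. -/
structure IsForm (c : ℤ → ℤ) (p h₁ k₁ h₂ k₂ : ℤ) : Prop where
  nonneg₁ : 0 ≤ k₁
  le₁ : k₁ ≤ h₁
  nonneg₂ : 0 ≤ k₂
  le₂ : k₂ ≤ h₂
  le₁₂ : h₁ ≤ h₂ + 1
  le₂₁ : h₂ ≤ h₁ + 1
  left : ∀ i ≤ p, c i = slope h₁ k₁ (p - i)
  right : ∀ i, p < i → c i = slope h₂ k₂ (i - p - 1)

/-- `slope h' k'` is obtained by adding one grain to `slope h k`. -/
def IsNext (h k h' k' : ℤ) : Prop := (k < h ∧ h' = h ∧ k' = k + 1) ∨ (k = h ∧ h' = h + 1 ∧ k' = 0)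

theorem IsNext.slope_eq {h k h' k' : ℤ} (hn : IsNext h k h' k') (hk : 0 ≤ k) {j : ℤ}
    (hj : 0 ≤ j) : slope h' k' j = slope h k j + if j = h - k then 1 else 0 := by
  unfold slope
  rcases hn with ⟨h1, rfl, rfl⟩ | ⟨rfl, rfl, rfl⟩ <;> split_ifs <;> omega

theorem slopeTail_sub {h k j : ℤ} (hk : 0 ≤ k) (hkh : k ≤ h) :
    slopeTail h k j - slopeTail h k (j + 1) = 2 * slope h k j := by
  unfold slopeTail slope
  rcases lt_trichotomy j (h - k) with hj | rfl | hj
  · rw [if_pos hj.le, if_pos (by omega), if_pos hj.le]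
    ring
  · rw [if_pos le_rfl, if_neg (by omega), if_pos le_rfl]
    split_ifs with h1
    · ring
    · obtain rfl : k = 0 := by omega
      ring
  · have e1 : ¬ j ≤ h - k := by omega
    have e2 : ¬ j + 1 ≤ h - k := by omega
    simp only [e1, e2, if_false]
    rcases lt_trichotomy j h with h1 | rfl | h1
    · rw [if_pos h1.le, if_pos (show j + 1 ≤ h by omega), if_pos h1.le]
      ring
    · rw [if_pos le_rfl, if_neg (show ¬ j + 1 ≤ j by omega), if_pos le_rfl]
      ring
    · have e3 : ¬ j ≤ h := by omega
      have e4 : ¬ j + 1 ≤ h := by omega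
      simp only [e3, e4, if_false]
      ring

/-- A valid slope without cliffs is a staircase. -/
theorem exists_eq_slope {f : ℤ → ℤ} (h0 : ∀ j, 0 ≤ f j) (h1 : ∀ j, 0 ≤ j → f j ≤ f (j + 1) + 1)
    (h2 : ∀ i j, 0 ≤ i → i < j → 0 < f j → f j + (j - i - 1) ≤ f i) :
    ∃ k, 0 ≤ k ∧ k ≤ f 0 ∧ ∀ j, 0 ≤ j → f j = slope (f 0) k j := by
  have hlow : ∀ (i : ℤ) (m : ℕ), 0 ≤ i → f i - m ≤ f (i + m) := by
    intro i m hi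
    induction m with
    | zero => simp
    | succ m ih =>
      have := h1 (i + m) (by omega)
      push_cast
      rw [← add_assoc]
      omega
  have hlow' : ∀ i j, 0 ≤ i → i ≤ j → f i - (j - i) ≤ f j := fun i j hi hij => by
    have := hlow i (j - i).toNat hi
    rwa [show ((j - i).toNat : ℤ) = j - i by omega, add_sub_cancel] at this
  by_cases hex : ∃ m : ℕ, 0 < f (m + 1) ∧ f (m + 1) = f 0 - m
  · -- The repeated height is that of the first column which lies too high.
    classical
    obtain ⟨hm1, hm2⟩ := Nat.find_spec hex
    have hmin : ∀ m < Nat.find hex, ¬ (0 < f (m + 1) ∧ f (m + 1) = f 0 - m) :=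
      fun m hm => Nat.find_min hex hm
    generalize Nat.find hex = m at hm1 hm2 hmin
    refine ⟨f (m + 1), hm1.le, by omega, fun j hj => ?_⟩
    unfold slope
    rcases le_or_gt j m with hjm | hjm
    · rw [if_pos (by omega)]
      rcases hj.eq_or_lt with rfl | hj
      · ring
      · have a1 := hlow' 0 j le_rfl hj.le
        have a2 := h2 0 j le_rfl hj (by omega)
        have a3 := hmin (j - 1).toNat (by omega)
        rw [show ((j - 1).toNat : ℤ) = j - 1 by omega, sub_add_cancel] at a3
        omega
    · rw [if_neg (by omega)]
      have a1 := hlow' (m + 1) j (by omega) (by omega)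
      have a2 := h2 0 j le_rfl (by omega)
      have a3 := h0 j
      split_ifs <;> omega
  · push Not at hex
    refine ⟨0, le_rfl, h0 0, fun j hj => ?_⟩
    unfold slope
    rcases hj.eq_or_lt with rfl | hj
    · have := h0 0
      rw [if_pos (by omega)]
      ring
    · have a0 := h0 j
      have a1 := hlow' 0 j le_rfl hj.le
      have a2 := h2 0 j le_rfl hj
      have a3 := hex (j - 1).toNat
      rw [show ((j - 1).toNat : ℤ) = j - 1 by omega, sub_add_cancel] at a3
      split_ifs <;> omega

theorem IsForm.split {c : ℤ → ℤ} {p h₁ k₁ h₂ k₂ : ℤ} (h : IsForm c p h₁ k₁ h₂ k₂) : Split c p := by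
  have n1 := h.nonneg₁
  have n2 := h.nonneg₂
  constructor
  · intro i j hij hj hi
    rw [h.left i (by omega)] at hi ⊢
    rw [h.left j hj]
    unfold slope at hi ⊢
    split_ifs at hi ⊢ <;> omega
  · intro i j hi hij hj
    rw [h.right j (by omega)] at hj ⊢
    rw [h.right i hi]
    unfold slope at hj ⊢
    split_ifs at hj ⊢ <;> omega

theorem slope_zero {h k : ℤ} (hk : k ≤ h) : slope h k 0 = h := by
  unfold slope
  rw [if_pos (by omega), sub_zero]

theorem IsForm.stuck {a : Config} {p h₁ k₁ h₂ k₂ : ℤ} (h : IsForm (height a) p h₁ k₁ h₂ k₂) :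
    Stuck a := by
  have n1 := h.nonneg₁
  have n2 := h.nonneg₂
  have key : ∀ i, height a (i + 1) ≤ height a i + 1 ∧ height a i ≤ height a (i + 1) + 1 := by
    intro i
    rcases lt_trichotomy i p with hi | rfl | hi
    · rw [h.left i hi.le, h.left (i + 1) (by omega)]
      unfold slope
      split_ifs <;> omega
    · rw [h.left i le_rfl, h.right (i + 1) (by omega), sub_self,
        show i + 1 - i - 1 = 0 by ring, slope_zero h.le₁, slope_zero h.le₂]
      exact ⟨h.le₂₁, h.le₁₂⟩
    · rw [h.right i hi, h.right (i + 1) (by omega)]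
      unfold slope
      split_ifs <;> omega
  intro i
  rw [canLeft_iff, canRight_iff]
  have a1 := key i
  have a2 := key (i - 1)
  rw [sub_add_cancel] at a2
  omega

theorem Stuck.exists_isForm {a : Config} {p : ℤ} (hs : Stuck a) (h : Split (height a) p) :
    ∃ h₁ k₁ h₂ k₂, IsForm (height a) p h₁ k₁ h₂ k₂ := by
  have key : ∀ i, height a (i + 1) ≤ height a i + 1 ∧ height a i ≤ height a (i + 1) + 1 := by
    intro i
    have h1 := (hs i).2
    have h2 := (hs (i + 1)).1
    rw [canRight_iff] at h1
    rw [canLeft_iff, add_sub_cancel_right] at h2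
    omega
  obtain ⟨k₁, a1, a2, a3⟩ := exists_eq_slope (f := fun j => height a (p - j))
    (fun j => height_nonneg a _)
    (fun j _ => by
      have := key (p - (j + 1))
      rw [show p - (j + 1) + 1 = p - j by ring] at this
      omega)
    (fun i j hi hij hj => by
      have := h.1 (p - j) (p - i) (by omega) (by omega) hj
      omega)
  obtain ⟨k₂, b1, b2, b3⟩ := exists_eq_slope (f := fun j => height a (p + 1 + j))
    (fun j => height_nonneg a _)
    (fun j _ => by
      have := key (p + 1 + j)
      rw [add_assoc (p + 1)] at this
      omega)
    (fun i j hi hij hj => by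
      have := h.2 (p + 1 + i) (p + 1 + j) (by omega) (by omega) hj
      omega)
  simp only [sub_zero, add_zero] at a2 a3 b2 b3
  refine ⟨_, k₁, _, k₂, a1, a2, b1, b2, (key p).2, (key p).1, fun i hi => ?_, fun i hi => ?_⟩
  · have := a3 (p - i) (by omega)
    rwa [sub_sub_cancel] at this
  · have := b3 (i - p - 1) (by omega)
    rwa [show p + 1 + (i - p - 1) = i by ring] at this

theorem IsForm.prefixSum_eq {a : Config} {p h₁ k₁ h₂ k₂ : ℤ}
    (h : IsForm (height a) p h₁ k₁ h₂ k₂) : 2 * prefixSum a p = h₁ * (h₁ + 1) + 2 * k₁ := by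
  have key : ∀ m : ℕ, 2 * prefixSum a p - 2 * prefixSum a (p - m) =
      slopeTail h₁ k₁ 0 - slopeTail h₁ k₁ m := by
    intro m
    induction m with
    | zero => simp
    | succ m ih =>
      have e1 := prefixSum_eq_add a (p - m)
      have e2 := slopeTail_sub (j := m) h.nonneg₁ h.le₁
      rw [h.left _ (by omega), sub_sub_cancel] at e1
      push_cast
      rw [← sub_sub]
      omega
  obtain ⟨N, hN0, hN, -⟩ := exists_bound a
  have hh := h.nonneg₁.trans h.le₁
  have e := key (N + |p| + h₁ + 1).toNat
  have hp := le_abs_self p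
  have hp' := abs_nonneg p
  have n1 := h.nonneg₁
  have n2 := h.le₁
  rw [show ((N + |p| + h₁ + 1).toNat : ℤ) = N + |p| + h₁ + 1 by omega,
    hN (p - _) (by omega)] at e
  simp only [slopeTail] at e
  rw [if_pos (by omega), if_neg (by omega), if_neg (by omega)] at e
  linarith

theorem IsForm.total_sub_eq {a : Config} {p h₁ k₁ h₂ k₂ : ℤ}
    (h : IsForm (height a) p h₁ k₁ h₂ k₂) :
    2 * (total a - prefixSum a p) = h₂ * (h₂ + 1) + 2 * k₂ := by
  have key : ∀ m : ℕ, 2 * prefixSum a (p + m) - 2 * prefixSum a p =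
      slopeTail h₂ k₂ 0 - slopeTail h₂ k₂ m := by
    intro m
    induction m with
    | zero => simp
    | succ m ih =>
      have e1 := prefixSum_eq_add a (p + m + 1)
      have e2 := slopeTail_sub (j := m) h.nonneg₂ h.le₂
      rw [h.right _ (by omega), add_sub_cancel_right, show p + m + 1 - p - 1 = (m : ℤ) by ring]
        at e1
      push_cast
      rw [← add_assoc]
      omega
  obtain ⟨N, hN0, -, hN⟩ := exists_bound a
  have hh := h.nonneg₂.trans h.le₂
  have e := key (N + |p| + h₂ + 1).toNat
  have hp := neg_abs_le p
  have hp' := abs_nonneg p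
  have n1 := h.nonneg₂
  have n2 := h.le₂
  rw [show ((N + |p| + h₂ + 1).toNat : ℤ) = N + |p| + h₂ + 1 by omega,
    hN (p + _) (by omega)] at e
  simp only [slopeTail] at e
  rw [if_pos (by omega), if_neg (by omega), if_neg (by omega)] at e
  linarith

theorem eq_of_slope_card_eq {h k h' k' : ℤ} (hk : 0 ≤ k) (hkh : k ≤ h) (hk' : 0 ≤ k')
    (hkh' : k' ≤ h') (he : h * (h + 1) + 2 * k = h' * (h' + 1) + 2 * k') : h = h' ∧ k = k' := by
  obtain rfl : h = h' := by
    rcases lt_trichotomy h h' with hlt | heq | hlt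
    · nlinarith
    · exact heq
    · nlinarith
  exact ⟨rfl, by omega⟩

theorem eq_of_isForm {a b : Config} {p h₁ k₁ h₂ k₂ : ℤ} (ha : IsForm (height a) p h₁ k₁ h₂ k₂)
    (hb : IsForm (height b) p h₁ k₁ h₂ k₂) : a = b := by
  refine eq_of_height_eq fun i => ?_
  rcases le_or_gt i p with hi | hi
  · rw [ha.left i hi, hb.left i hi]
  · rw [ha.right i hi, hb.right i hi]

end SandPile

/-! ### The index of a fixed point -/

namespace SandPile

/-- The properties of the fixed points of `SSPM(n)` that determine their shape. -/
structure Settled (n : ℕ) (a : Config) : Prop where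
  stuck : Stuck a
  total_eq : total a = n
  hasSplit : HasSplit a

/-- The index of a fixed point with `n` grains and split `p`. By `Settled.index_congr` it does not
depend on the choice of the split. -/
noncomputable def index (n : ℕ) (a : Config) (p : ℤ) : ℤ := prefixSum a p - Nat.sqrt n * p

variable {n : ℕ} {a b : Config} {p q h₁ k₁ h₂ k₂ : ℤ}

theorem IsForm.height_eq (h : IsForm (height a) p h₁ k₁ h₂ k₂) : height a p = h₁ := by
  rw [h.left p le_rfl, sub_self, slope_zero h.le₁]

theorem IsForm.card_eq (h : IsForm (height a) p h₁ k₁ h₂ k₂) (ha : total a = n) :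
    2 * (n : ℤ) = h₁ * (h₁ + 1) + 2 * k₁ + (h₂ * (h₂ + 1) + 2 * k₂) := by
  have e1 := h.prefixSum_eq
  have e2 := h.total_sub_eq
  rw [ha] at e2
  linarith

theorem sqrt_eq_of_sq_le {h : ℤ} (h0 : 0 ≤ h) (h1 : h ^ 2 ≤ n) (h2 : (n : ℤ) < (h + 1) ^ 2) :
    (Nat.sqrt n : ℤ) = h := by
  lift h to ℕ using h0
  norm_cast at h1 h2 ⊢
  exact (Nat.eq_sqrt'.2 ⟨h1, h2⟩).symm

theorem le_sqrt_of_sq_le {h : ℤ} (h0 : 0 ≤ h) (h1 : h ^ 2 ≤ n) : h ≤ Nat.sqrt n := by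
  lift h to ℕ using h0
  norm_cast at h1 ⊢
  exact Nat.le_sqrt'.2 h1

/-- The split can be moved by one column to the left exactly if the left staircase is higher than
the right one, or as high as the right one, which then has no plateau. -/
theorem IsForm.split_left_iff (h : IsForm (height a) p h₁ k₁ h₂ k₂) :
    Split (height a) (p - 1) ↔ h₁ = h₂ + 1 ∨ (h₁ = h₂ ∧ k₂ = 0) := by
  have n1 := h.nonneg₂
  have n2 := h.le₂
  have n3 := h.le₁₂
  have n4 := h.nonneg₁
  have n5 := h.le₁
  constructor
  · intro hs
    by_contra! hne
    rcases (show h₂ = 0 ∨ 0 < h₂ by omega) with h0 | h0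
    · omega
    have e1 := h.right (p + 1) (by omega)
    rw [show p + 1 - p - 1 = 0 by ring, slope_zero h.le₂] at e1
    have v1 := hs.2 p (p + 1) (by omega) (by omega) (by omega)
    rw [h.height_eq] at v1
    -- The column on which the repetition of the height `k₂` occurs.
    have e2 := h.right (p + 1 + (h₂ - k₂ + 1)) (by omega)
    rw [show p + 1 + (h₂ - k₂ + 1) - p - 1 = h₂ - k₂ + 1 by ring, slope,
      if_neg (by omega), if_pos (by omega)] at e2
    have v2 := hs.2 p (p + 1 + (h₂ - k₂ + 1)) (by omega) (by omega) (by omega)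
    rw [h.height_eq] at v2
    omega
  · intro hc
    refine ⟨h.split.1.mono (by omega), fun i j hi hij hj => ?_⟩
    rcases (show i = p ∨ p < i by omega) with rfl | hi
    · rw [h.right j hij] at hj ⊢
      rw [h.height_eq]
      unfold slope at hj ⊢
      split_ifs at hj ⊢ <;> omega
    · exact h.split.2 i j hi hij hj

theorem IsForm.split_right_of (h : IsForm (height a) p h₁ k₁ h₂ k₂)
    (hc : h₂ = h₁ + 1 ∨ (h₂ = h₁ ∧ k₁ = 0)) : Split (height a) (p + 1) := by
  have n1 := h.nonneg₂
  have n2 := h.le₂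
  have n3 := h.le₁₂
  have n4 := h.nonneg₁
  have n5 := h.le₁
  refine ⟨fun i j hij hj hi => ?_, h.split.2.mono (by omega)⟩
  rcases (show j = p + 1 ∨ j ≤ p by omega) with rfl | hj
  · rw [h.left i (by omega)] at hi ⊢
    rw [h.right (p + 1) (by omega), show p + 1 - p - 1 = 0 by ring, slope_zero h.le₂]
    unfold slope at hi ⊢
    split_ifs at hi ⊢ <;> omega
  · exact h.split.1 i j hij hj hi

theorem IsForm.sqrt_eq (h : IsForm (height a) p h₁ k₁ h₂ k₂) (ha : total a = n)
    (hs : Split (height a) (p - 1)) : (Nat.sqrt n : ℤ) = h₁ := by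
  have e := h.card_eq ha
  have n1 := h.nonneg₂
  have n2 := h.le₂
  have n4 := h.nonneg₁
  have n5 := h.le₁
  rcases h.split_left_iff.1 hs with h1 | ⟨h1, h2⟩
  · obtain rfl : h₂ = h₁ - 1 := by omega
    exact sqrt_eq_of_sq_le (by omega) (by nlinarith) (by nlinarith)
  · subst h1 h2
    exact sqrt_eq_of_sq_le (by omega) (by nlinarith) (by nlinarith)

/-- The index is the same for two adjacent splits, because the column between them has height `√n`,
rounded down. -/
theorem Settled.index_sub_one (ha : Settled n a) (hp : Split (height a) p)
    (hq : Split (height a) (p - 1)) : index n a (p - 1) = index n a p := by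
  obtain ⟨h₁, k₁, h₂, k₂, h⟩ := ha.stuck.exists_isForm hp
  have e1 := h.sqrt_eq ha.total_eq hq
  have e2 := prefixSum_eq_add a p
  rw [h.height_eq] at e2
  unfold index
  rw [e1]
  linarith

theorem Settled.index_congr_of_le (ha : Settled n a) (hp : Split (height a) p)
    (hq : Split (height a) q) (hqp : q ≤ p) : index n a q = index n a p := by
  have key : ∀ m : ℕ, q ≤ p - m → index n a (p - m) = index n a p := by
    intro m
    induction m with
    | zero => simp
    | succ m ih =>
      intro hm
      push_cast at hm ⊢
      rw [← ih (by omega), ← sub_sub]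
      have hs : ∀ t, q ≤ t → t ≤ p → Split (height a) t := fun t h1 h2 =>
        ⟨hp.1.mono h2, hq.2.mono h1⟩
      exact ha.index_sub_one (hs _ (by omega) (by omega)) (hs _ (by omega) (by omega))
  have := key (p - q).toNat (by omega)
  rwa [show p - ((p - q).toNat : ℤ) = q by omega] at this

theorem Settled.index_congr (ha : Settled n a) (hp : Split (height a) p)
    (hq : Split (height a) q) : index n a q = index n a p := by
  rcases le_total q p with h | h
  · exact ha.index_congr_of_le hp hq h
  · exact (ha.index_congr_of_le hq hp h).symm

/-- If the split cannot be moved to the left, then there are not too many grains on the left. -/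
theorem Settled.two_mul_prefixSum_lt (ha : Settled n a) (hp : Split (height a) p)
    (hq : ¬ Split (height a) (p - 1)) : 2 * prefixSum a p < n + Nat.sqrt n := by
  obtain ⟨h₁, k₁, h₂, k₂, h⟩ := ha.stuck.exists_isForm hp
  have e := h.card_eq ha.total_eq
  have e1 := h.prefixSum_eq
  have n1 := h.nonneg₂
  have n2 := h.le₂
  have n3 := h.le₂₁
  have n4 := h.nonneg₁
  have n5 := h.le₁
  have n6 := h.le₁₂
  rw [h.split_left_iff] at hq
  rcases (show h₂ = h₁ + 1 ∨ (h₂ = h₁ ∧ 0 < k₂) by omega) with rfl | ⟨rfl, h2⟩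
  · have := Int.natCast_nonneg (Nat.sqrt n)
    nlinarith
  · have := le_sqrt_of_sq_le (n := n) (h := h₂) (by omega) (by nlinarith)
    linarith

theorem Settled.lt_two_mul_prefixSum (ha : Settled n a) (hp : Split (height a) p)
    (hq : ¬ Split (height a) (p + 1)) : (n : ℤ) - Nat.sqrt n < 2 * prefixSum a p := by
  obtain ⟨h₁, k₁, h₂, k₂, h⟩ := ha.stuck.exists_isForm hp
  have e := h.card_eq ha.total_eq
  have e1 := h.prefixSum_eq
  have n1 := h.nonneg₂
  have n2 := h.le₂
  have n3 := h.le₂₁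
  have n4 := h.nonneg₁
  have n5 := h.le₁
  have n6 := h.le₁₂
  have hq := mt h.split_right_of hq
  rcases (show h₁ = h₂ + 1 ∨ (h₁ = h₂ ∧ 0 < k₁) by omega) with rfl | ⟨rfl, h2⟩
  · have := Int.natCast_nonneg (Nat.sqrt n)
    nlinarith
  · have := le_sqrt_of_sq_le (n := n) (h := h₁) (by omega) (by nlinarith)
    linarith

theorem Settled.eq_of_index_eq_of_le (ha : Settled n a) (hb : Settled n b)
    (hp : Split (height a) p) (hq : Split (height b) q) (hqp : q ≤ p)
    (he : index n a p = index n b q) : a = b := by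
  induction hd : (p - q).toNat generalizing p q with
  | zero =>
    obtain rfl : p = q := by omega
    obtain ⟨h₁, k₁, h₂, k₂, h⟩ := ha.stuck.exists_isForm hp
    obtain ⟨h₁', k₁', h₂', k₂', h'⟩ := hb.stuck.exists_isForm hq
    have he : prefixSum a p = prefixSum b p := by
      unfold index at he
      linarith
    have e1 := h.prefixSum_eq
    have e2 := h.total_sub_eq
    rw [he] at e1 e2
    rw [ha.total_eq, ← hb.total_eq] at e2
    obtain ⟨rfl, rfl⟩ := eq_of_slope_card_eq h.nonneg₁ h.le₁ h'.nonneg₁ h'.le₁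
      (e1.symm.trans h'.prefixSum_eq)
    obtain ⟨rfl, rfl⟩ := eq_of_slope_card_eq h.nonneg₂ h.le₂ h'.nonneg₂ h'.le₂
      (e2.symm.trans h'.total_sub_eq)
    exact eq_of_isForm h h'
  | succ d ih =>
    by_cases h1 : Split (height a) (p - 1)
    · exact ih h1 hq (by omega) (by rw [ha.index_sub_one hp h1, he]) (by omega)
    by_cases h2 : Split (height b) (q + 1)
    · refine ih hp h2 (by omega) ?_ (by omega)
      rw [he, hb.index_congr h2 hq]
    -- Otherwise the index of `a` is smaller than that of `b`.
    have e1 := ha.two_mul_prefixSum_lt hp h1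
    have e2 := hb.lt_two_mul_prefixSum hq h2
    unfold index at he
    have h0 := Int.natCast_nonneg (Nat.sqrt n)
    have h3 : (Nat.sqrt n : ℤ) * 1 ≤ Nat.sqrt n * (p - q) :=
      mul_le_mul_of_nonneg_left (by omega) h0
    rw [mul_sub] at h3
    exfalso
    linarith

theorem Settled.eq_of_index_eq (ha : Settled n a) (hb : Settled n b)
    (hp : Split (height a) p) (hq : Split (height b) q) (he : index n a p = index n b q) :
    a = b := by
  rcases le_total q p with h | h
  · exact ha.eq_of_index_eq_of_le hb hp hq h he
  · exact (hb.eq_of_index_eq_of_le ha hq hp h he.symm).symm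

/-! ### The successor of a fixed point -/

theorem prefixSum_add (a b : Config) (i : ℤ) :
    prefixSum (a + b) i = prefixSum a i + prefixSum b i :=
  Finsupp.sum_add_index' (fun j => by simp) fun j v w => by
    push_cast
    split_ifs <;> simp

theorem prefixSum_single (j i : ℤ) :
    prefixSum (Finsupp.single j 1) i = if j ≤ i then 1 else 0 := by
  unfold prefixSum
  rw [Finsupp.sum_single_index (by simp)]
  simp

theorem total_add (a b : Config) : total (a + b) = total a + total b :=
  Finsupp.sum_add_index' (fun j => by simp) fun j v w => by push_cast; rfl

theorem total_single (j : ℤ) : total (Finsupp.single j 1) = 1 := by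
  unfold total
  rw [Finsupp.sum_single_index (by simp)]
  simp

/-- The number of grains on the left staircase can be increased by one at the expense of the right
staircase whenever the resulting heights are compatible. -/
theorem Settled.exists_next_of_isForm {h₁' k₁' h₂' k₂' : ℤ} (ha : Settled n a)
    (h : IsForm (height a) p h₁ k₁ h₂ k₂) (hl : IsNext h₁ k₁ h₁' k₁') (hr : IsNext h₂' k₂' h₂ k₂)
    (hk : 0 ≤ k₂') (hle : h₁' ≤ h₂' + 1) (hle' : h₂' ≤ h₁' + 1) :
    ∃ b, Settled n b ∧ Split (height b) p ∧ Closer a b ∧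
      (∀ i, prefixSum a i ≤ prefixSum b i) ∧ index n b p = index n a p + 1 := by
  have n4 := h.nonneg₁
  have n5 := h.le₁
  have hk2 : k₂' ≤ h₂' := by
    rcases hr with h1 | h1 <;> omega
  -- The columns that gain and lose a grain.
  obtain ⟨i, hi⟩ : ∃ i, i = p - (h₁ - k₁) := ⟨_, rfl⟩
  obtain ⟨j, hj⟩ : ∃ j, j = p + 1 + (h₂' - k₂') := ⟨_, rfl⟩
  have hpos : 1 ≤ height a j := by
    have e := hr.slope_eq hk (j := j - p - 1) (by omega)
    rw [if_pos (by omega)] at e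
    rw [h.right j (by omega), e]
    unfold slope
    split_ifs <;> omega
  obtain ⟨b, hb⟩ : ∃ b : Config, b + Finsupp.single j 1 = a + Finsupp.single i 1 := by
    refine ⟨a + Finsupp.single i 1 - Finsupp.single j 1, tsub_add_cancel_of_le ?_⟩
    rw [Finsupp.single_le_iff, Finsupp.add_apply]
    unfold height at hpos
    omega
  have hbm : ∀ m, height b m =
      height a m + (if m = i then 1 else 0) - (if m = j then 1 else 0) := by
    intro m
    have := DFunLike.congr_fun hb m
    simp only [Finsupp.add_apply, Finsupp.single_apply, eq_comm (b := m)] at this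
    unfold height
    split_ifs at this ⊢ <;> omega
  have hpre : ∀ m, prefixSum b m + (if j ≤ m then 1 else 0) =
      prefixSum a m + (if i ≤ m then 1 else 0) := by
    intro m
    rw [← prefixSum_single, ← prefixSum_single, ← prefixSum_add, ← prefixSum_add, hb]
  have htot : total b = total a := by
    have := congrArg total hb
    rw [total_add, total_add, total_single, total_single] at this
    omega
  have hform : IsForm (height b) p h₁' k₁' h₂' k₂' := by
    refine ⟨?_, ?_, hk, hk2, hle, hle', fun m hm => ?_, fun m hm => ?_⟩
    · rcases hl with h1 | h1 <;> omega
    · rcases hl with h1 | h1 <;> omega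
    · rw [hbm, hl.slope_eq n4 (by omega), h.left m hm]
      split_ifs <;> omega
    · have := hr.slope_eq hk (j := m - p - 1) (by omega)
      rw [hbm, h.right m hm, this]
      split_ifs <;> omega
  refine ⟨b, ⟨hform.stuck, htot.trans ha.total_eq, p, hform.split⟩, hform.split,
    ⟨i, j, by omega, fun m => ?_⟩, fun m => ?_, ?_⟩
  · have := hbm m
    unfold height at this
    split_ifs at this ⊢ <;> omega
  · have := hpre m
    split_ifs at this <;> omega
  · have := hpre p
    rw [if_neg (by omega), if_pos (by omega)] at this
    unfold index
    linarith

/-- The two staircases with respect to the split `p - 1`, if it exists. -/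
theorem IsForm.exists_isForm_left (h : IsForm (height a) p h₁ k₁ h₂ k₂) (h0 : 0 < h₁)
    (hc : h₁ = h₂ + 1 ∨ (h₁ = h₂ ∧ k₂ = 0)) :
    ∃ h₁' k₁' k₂', IsForm (height a) (p - 1) h₁' k₁' h₁ k₂' ∧
      (k₁ = h₁ ∧ h₁' = h₁ ∧ k₁' = 0 ∨ k₁ < h₁ ∧ h₁' = h₁ - 1 ∧ k₁' = k₁) ∧
      (h₁ = h₂ + 1 ∧ k₂' = k₂ ∨ h₁ = h₂ ∧ k₂' = h₁) := by
  have n1 := h.nonneg₂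
  have n2 := h.le₂
  have n4 := h.nonneg₁
  have n5 := h.le₁
  obtain ⟨h₁', k₁', e1⟩ : ∃ h₁' k₁', (k₁ = h₁ ∧ h₁' = h₁ ∧ k₁' = 0) ∨
      (k₁ < h₁ ∧ h₁' = h₁ - 1 ∧ k₁' = k₁) := by
    rcases n5.lt_or_eq with h1 | h1
    · exact ⟨_, _, Or.inr ⟨h1, rfl, rfl⟩⟩
    · exact ⟨_, _, Or.inl ⟨h1, rfl, rfl⟩⟩
  obtain ⟨k₂', e2⟩ : ∃ k₂', (h₁ = h₂ + 1 ∧ k₂' = k₂) ∨ (h₁ = h₂ ∧ k₂' = h₁) := by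
    rcases hc with h1 | h1
    · exact ⟨_, Or.inl ⟨h1, rfl⟩⟩
    · exact ⟨_, Or.inr ⟨h1.1, rfl⟩⟩
  refine ⟨h₁', k₁', k₂', ⟨by omega, by omega, by omega, by omega, by omega, by omega,
    fun i hi => ?_, fun i hi => ?_⟩, e1, e2⟩
  · rw [h.left i (by omega)]
    unfold slope
    split_ifs <;> omega
  · rcases (show i = p ∨ p < i by omega) with rfl | hi
    · rw [h.height_eq, show i - (i - 1) - 1 = 0 by ring, slope_zero (by omega)]
    · rw [h.right i hi]
      unfold slope
      split_ifs <;> omega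

/-- Every fixed point with at least one grain has a successor. If the number of grains to the left
of a split cannot be increased, then the split can be moved to the left, and there it can. -/
theorem Settled.exists_next (ha : Settled n a) (hn : 0 < n) (hp : Split (height a) p) :
    ∃ b q, Settled n b ∧ Split (height b) q ∧ Closer a b ∧
      (∀ i, prefixSum a i ≤ prefixSum b i) ∧ index n b q = index n a p + 1 := by
  obtain ⟨h₁, k₁, h₂, k₂, h⟩ := ha.stuck.exists_isForm hp
  have n1 := h.nonneg₂
  have n2 := h.le₂
  have n3 := h.le₂₁
  have n4 := h.nonneg₁
  have n5 := h.le₁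
  have n6 := h.le₁₂
  have hpos : 0 < h₁ ∨ 0 < h₂ := by
    by_contra! hne
    have e := h.card_eq ha.total_eq
    obtain rfl : h₁ = 0 := by omega
    obtain rfl : h₂ = 0 := by omega
    omega
  by_cases hstay : (k₁ < h₁ ∧ 0 < k₂) ∨ (k₁ < h₁ ∧ k₂ = 0 ∧ h₁ ≤ h₂) ∨
      (k₁ = h₁ ∧ 0 < k₂ ∧ h₁ ≤ h₂) ∨ (k₁ = h₁ ∧ k₂ = 0 ∧ h₁ < h₂)
  · suffices ∃ h₁' k₁' h₂' k₂', IsNext h₁ k₁ h₁' k₁' ∧ IsNext h₂' k₂' h₂ k₂ ∧ 0 ≤ k₂' ∧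
        h₁' ≤ h₂' + 1 ∧ h₂' ≤ h₁' + 1 by
      obtain ⟨h₁', k₁', h₂', k₂', a1, a2, a3, a4, a5⟩ := this
      obtain ⟨b, hb⟩ := ha.exists_next_of_isForm h a1 a2 a3 a4 a5
      exact ⟨b, p, hb⟩
    rcases hstay with h1 | h1 | h1 | h1
    · exact ⟨h₁, k₁ + 1, h₂, k₂ - 1, Or.inl (by omega), Or.inl (by omega), by omega, by omega,
        by omega⟩
    · exact ⟨h₁, k₁ + 1, h₂ - 1, h₂ - 1, Or.inl (by omega), Or.inr (by omega), by omega, by omega,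
        by omega⟩
    · exact ⟨h₁ + 1, 0, h₂, k₂ - 1, Or.inr (by omega), Or.inl (by omega), by omega, by omega,
        by omega⟩
    · exact ⟨h₁ + 1, 0, h₂ - 1, h₂ - 1, Or.inr (by omega), Or.inr (by omega), by omega, by omega,
        by omega⟩
  · have hc : h₁ = h₂ + 1 ∨ (h₁ = h₂ ∧ k₂ = 0) := by omega
    obtain ⟨h₁', k₁', k₂', h', e1, e2⟩ := h.exists_isForm_left (by omega) hc
    rw [← ha.index_sub_one hp h'.split]
    suffices ∃ h₁'' k₁'' h₂'' k₂'', IsNext h₁' k₁' h₁'' k₁'' ∧ IsNext h₂'' k₂'' h₁ k₂' ∧ 0 ≤ k₂'' ∧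
        h₁'' ≤ h₂'' + 1 ∧ h₂'' ≤ h₁'' + 1 by
      obtain ⟨h₁'', k₁'', h₂'', k₂'', a1, a2, a3, a4, a5⟩ := this
      obtain ⟨b, hb⟩ := ha.exists_next_of_isForm h' a1 a2 a3 a4 a5
      exact ⟨b, p - 1, hb⟩
    rcases (show (k₁' < h₁' ∧ 0 < k₂') ∨ (k₁' < h₁' ∧ k₂' = 0 ∧ h₁' ≤ h₁) ∨
      (k₁' = h₁' ∧ k₂' = 0 ∧ h₁' < h₁) by omega) with h1 | h1 | h1
    · exact ⟨h₁', k₁' + 1, h₁, k₂' - 1, Or.inl (by omega), Or.inl (by omega), by omega, by omega,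
        by omega⟩
    · exact ⟨h₁', k₁' + 1, h₁ - 1, h₁ - 1, Or.inl (by omega), Or.inr (by omega), by omega,
        by omega, by omega⟩
    · exact ⟨h₁' + 1, 0, h₁ - 1, h₁ - 1, Or.inr (by omega), Or.inr (by omega), by omega, by omega,
        by omega⟩

theorem Settled.index_eq_zero (ha : Settled 0 a) (p : ℤ) : index 0 a p = 0 := by
  have h1 : 0 ≤ prefixSum a p := Finset.sum_nonneg fun j _ => by
    dsimp only
    split_ifs <;> omega
  have h2 : prefixSum a p ≤ total a := Finset.sum_le_sum fun j _ => by
    dsimp only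
    split_ifs <;> omega
  rw [ha.total_eq] at h2
  unfold index
  rw [Nat.sqrt_zero]
  omega

/-- The prefix sums of the fixed points are pointwise monotone in the index. -/
theorem Settled.prefixSum_le (ha : Settled n a) (hb : Settled n b) (hp : Split (height a) p)
    (hq : Split (height b) q) (hle : index n a p ≤ index n b q) (i : ℤ) :
    prefixSum a i ≤ prefixSum b i := by
  induction hd : (index n b q - index n a p).toNat generalizing a p with
  | zero => rw [ha.eq_of_index_eq hb hp hq (by omega)]
  | succ d ih =>
    rcases n.eq_zero_or_pos with rfl | hn
    · rw [ha.index_eq_zero, hb.index_eq_zero] at hd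
      simp at hd
    · obtain ⟨c, r, hc, hr, -, h1, h2⟩ := ha.exists_next hn hp
      exact (h1 i).trans (ih hc hr (by omega) (by omega))

theorem toLex_le_of_prefixSum_le (h : ∀ i, prefixSum a i ≤ prefixSum b i) :
    toLex a ≤ toLex b := by
  by_contra! hlt
  obtain ⟨i, h1, h2⟩ := Finsupp.Lex.lt_iff.1 hlt
  have key : prefixSum b (i - 1) = prefixSum a (i - 1) := by
    classical
    unfold prefixSum
    rw [Finsupp.sum_of_support_subset b (Finset.subset_union_left (s₂ := a.support)) _ (by simp),
      Finsupp.sum_of_support_subset a (Finset.subset_union_right (s₁ := b.support)) _ (by simp)]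
    refine Finset.sum_congr rfl fun j _ => ?_
    split_ifs with hj
    · exact congrArg _ (h1 j (by omega))
    · rfl
  have e1 := prefixSum_eq_add a i
  have e2 := prefixSum_eq_add b i
  have e4 := h i
  have e5 : height b i < height a i := by
    unfold height
    exact_mod_cast h2
  omega

theorem Settled.toLex_lt_iff (ha : Settled n a) (hb : Settled n b) (hp : Split (height a) p)
    (hq : Split (height b) q) : toLex a < toLex b ↔ index n a p < index n b q := by
  constructor
  · intro h
    by_contra! hle
    exact absurd (toLex_le_of_prefixSum_le (hb.prefixSum_le ha hq hp hle)) h.not_ge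
  · intro h
    refine (toLex_le_of_prefixSum_le (ha.prefixSum_le hb hp hq h.le)).lt_of_ne fun he => ?_
    obtain rfl : a = b := toLex.injective he
    rw [ha.index_congr hq hp] at h
    exact lt_irrefl _ h

theorem Settled.closer_of_index_eq (ha : Settled n a) (hb : Settled n b)
    (hp : Split (height a) p) (hq : Split (height b) q) (he : index n b q = index n a p + 1) :
    Closer a b := by
  rcases n.eq_zero_or_pos with rfl | hn
  · rw [ha.index_eq_zero, hb.index_eq_zero] at he
    omega
  · obtain ⟨c, r, hc, hr, h1, -, h2⟩ := ha.exists_next hn hp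
    rwa [hb.eq_of_index_eq hc hq hr (by omega)]

end SandPile

/-! ### The fixed points of the parallel model form an interval -/

namespace SandPile

variable {n t : ℕ} {a b : Config} {p q : ℤ}

theorem settled_of_mem_sspmFixedPoints (h : a ∈ sspmFixedPoints n) : Settled n a :=
  ⟨forall_not_seqStep_iff.1 h.2, total_of_reachable h.1, hasSplit_of_reachable h.1⟩

theorem psspmFixedPoints_subset (n : ℕ) : psspmFixedPoints n ⊆ sspmFixedPoints n := by
  intro a ha
  have h := ha
  rw [psspmFixedPoints_eq_stage] at h
  exact ⟨mem_seq_reachable h, forall_not_seqStep_iff.2 (forall_not_parStep_iff.1 ha.2)⟩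

/-- Along an edge the index increases by `0` or `1`. -/
theorem Edge.index_le (h : Edge a b) (ha : Settled n a) (hb : Settled n b)
    (hp : Split (height a) p) (hq : Split (height b) q) :
    index n a p ≤ index n b q ∧ index n b q ≤ index n a p + 1 := by
  obtain ⟨h1, r, h2, h3⟩ := h
  rw [ha.index_congr h2 hp, hb.index_congr h3 hq]
  have := h1 r
  unfold index
  omega

/-- An integer-valued function that changes by at most one along each edge takes all intermediate
values. -/
theorem exists_eq_of_reflTransGen {α : Type*} {S : Set α} {r : α → α → Prop} {f : α → ℤ}
    (hr : ∀ x y, r x y → x ∈ S ∧ y ∈ S ∧ f y ≤ f x + 1) {x y : α}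
    (h : Relation.ReflTransGen r x y) (hx : x ∈ S) {v : ℤ} (hv : f x ≤ v) (hv' : v ≤ f y) :
    ∃ z ∈ S, f z = v := by
  induction h with
  | refl => exact ⟨x, hx, le_antisymm hv hv'⟩
  | tail _ h ih =>
    obtain ⟨-, h2, h3⟩ := hr _ _ h
    rcases hv'.eq_or_lt with h4 | h4
    · exact ⟨_, h2, h4.symm⟩
    · exact ih (by omega)

end SandPile

/-- Configurations are compared in `Lex SandPile.Config`, the lexicographic order on sequences
indexed by `ℤ` (the leftmost column on which two configurations differ decides). -/
theorem mainTheorem1 (n : ℕ) :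
    ∃ (k : ℕ) (π : Fin (k + 1) → SandPile.Config),
      -- `π 0 < π 1 < … < π k` is the list of all fixed points of `PSSPM(n)`
      StrictMono (fun i => toLex (π i)) ∧
      Set.range π = SandPile.psspmFixedPoints n ∧
      -- consecutive fixed points satisfy `π i ◁ π (i + 1)`
      (∀ i : Fin k, SandPile.Closer (π i.castSucc) (π i.succ)) ∧
      -- they are fixed points of `SSPM(n)`
      (∀ i, π i ∈ SandPile.sspmFixedPoints n) ∧
      -- and every fixed point of `SSPM(n)` between `π 0` and `π k` is one of them
      (∀ σ ∈ SandPile.sspmFixedPoints n,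
        toLex (π 0) ≤ toLex σ → toLex σ ≤ toLex (π (Fin.last k)) → ∃ i, π i = σ) := by
  classical
  -- A split and the corresponding index for every fixed point.
  choose! split hsplit using fun (a : SandPile.Config) (ha : SandPile.Settled n a) => ha.hasSplit
  let s : SandPile.Config → ℤ := fun a => SandPile.index n a (split a)
  have hset : ∀ a ∈ SandPile.psspmFixedPoints n, SandPile.Settled n a := fun a ha =>
    SandPile.settled_of_mem_sspmFixedPoints (SandPile.psspmFixedPoints_subset n ha)
  have hlt : ∀ {a b}, SandPile.Settled n a → SandPile.Settled n b →
      (toLex a < toLex b ↔ s a < s b) := fun ha hb =>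
    ha.toLex_lt_iff hb (hsplit _ ha) (hsplit _ hb)
  have hinj : ∀ {a b}, SandPile.Settled n a → SandPile.Settled n b → s a = s b → a = b :=
    fun ha hb he => ha.eq_of_index_eq hb (hsplit _ ha) (hsplit _ hb) he
  have hmem := SandPile.psspmFixedPoints_eq_stage n
  have hfin : (SandPile.psspmFixedPoints n).Finite := hmem ▸ SandPile.stage_finite n _
  have hne : (SandPile.psspmFixedPoints n).Nonempty := hmem ▸ SandPile.stage_nonempty n _
  obtain ⟨lo, hlo, hlo'⟩ := hfin.exists_minimalFor s _ hne
  obtain ⟨hi, hhi, hhi'⟩ := hfin.exists_maximalFor s _ hne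
  have hmin : ∀ a ∈ SandPile.psspmFixedPoints n, s lo ≤ s a := fun a ha => by
    by_contra! h
    exact absurd (hlo' ha h.le) h.not_ge
  have hmax : ∀ a ∈ SandPile.psspmFixedPoints n, s a ≤ s hi := fun a ha => by
    by_contra! h
    exact absurd (hhi' ha h.le) h.not_ge
  -- By connectedness, every index between the smallest and the largest one occurs.
  have hval : ∀ v, s lo ≤ v → v ≤ s hi → ∃ a ∈ SandPile.psspmFixedPoints n, s a = v := by
    intro v h1 h2
    refine SandPile.exists_eq_of_reflTransGen (r := SandPile.Link (SandPile.psspmFixedPoints n))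
      ?_ ?_ hlo h1 h2
    · rintro x y ⟨hx, hy, hxy⟩
      refine ⟨hx, hy, ?_⟩
      have hx' := hset x hx
      have hy' := hset y hy
      rcases hxy with h | h
      · exact (h.index_le hx' hy' (hsplit x hx') (hsplit y hy')).2
      · have := (h.index_le hy' hx' (hsplit y hy') (hsplit x hx')).1
        dsimp only [s]
        omega
    · rw [hmem] at hlo hhi ⊢
      exact SandPile.stage_connected hlo hhi
  have hle := hmin hi hhi
  choose! fixedPoint hat hat' using hval
  have hk : ∀ i : Fin ((s hi - s lo).toNat + 1),
      fixedPoint (s lo + i) ∈ SandPile.psspmFixedPoints n ∧ s (fixedPoint (s lo + i)) = s lo + i :=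
    fun i => ⟨hat _ (by omega) (by omega), hat' _ (by omega) (by omega)⟩
  have hex : ∀ a, SandPile.Settled n a → s lo ≤ s a → s a ≤ s hi →
      ∃ i : Fin ((s hi - s lo).toNat + 1), fixedPoint (s lo + i) = a := by
    intro a ha h1 h2
    refine ⟨⟨(s a - s lo).toNat, by omega⟩, hinj (hset _ (hk _).1) ha ?_⟩
    rw [(hk _).2]
    dsimp only
    omega
  refine ⟨(s hi - s lo).toNat, fun i => fixedPoint (s lo + i), fun i j hij => ?_, ?_, fun i => ?_,
    fun i => SandPile.psspmFixedPoints_subset n (hk i).1, fun σ hσ h1 h2 => ?_⟩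
  · refine (hlt (hset _ (hk i).1) (hset _ (hk j).1)).2 ?_
    rw [(hk i).2, (hk j).2]
    have : (i : ℕ) < j := hij
    omega
  · ext a
    constructor
    · rintro ⟨i, rfl⟩
      exact (hk i).1
    · intro ha
      exact hex a (hset a ha) (hmin a ha) (hmax a ha)
  · have h1 := hk i.castSucc
    have h2 := hk i.succ
    refine (hset _ h1.1).closer_of_index_eq (hset _ h2.1) (hsplit _ (hset _ h1.1))
      (hsplit _ (hset _ h2.1)) ?_
    change s _ = s _ + 1
    rw [h1.2, h2.2, Fin.val_succ, Fin.val_castSucc]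
    push_cast
    ring
  · have hσ' := SandPile.settled_of_mem_sspmFixedPoints hσ
    refine hex σ hσ' ?_ ?_
    · have h3 := mt (hlt hσ' (hset _ (hk 0).1)).2 h1.not_gt
      rw [(hk 0).2] at h3
      simp only [Fin.val_zero] at h3
      omega
    · have h3 := mt (hlt (hset _ (hk (Fin.last _)).1) hσ').2 h2.not_gt
      rw [(hk (Fin.last _)).2, Fin.val_last] at h3
      omega
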